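/- For complex $p$ with $0<|p|<1$ and $x\neq 0$ let $\theta(x;p)=\prod_{i\ge 0}(1-xp^i)(1-p^{i+1}/x)$, $(x;q,p)_n=\prod_{j=0}^{n-1}\theta(xq^j;p)$, $(x;q)_n=\prod_{j=0}^{n-1}(1-xq^j)$; several parameters before the semicolon denote the product of the corresponding symbols. Let $${}_{r+1}V_r(a_1;a_6,\dots,a_{r+1};q,p)=\sum_{k=0}^\infty\frac{\theta(a_1q^{2k};p)}{\theta(a_1;p)}\frac{(a_1,a_6,\dots,a_{r+1};q,p)_k}{(q,a_1q/a_6,\dots,a_1q/a_{r+1};q,p)_k}q^k,$$ $${}_{r+1}W_r(a_1;a_4,\dots,a_{r+1};q,z)=\sum_{k=0}^\infty\frac{1-a_1q^{2k}}{1-a_1}\frac{(a_1,a_4,\dots,a_{r+1};q)_k}{(q,a_1q/a_4,\dots,a_1q/a_{r+1};q)_k}z^k,$$ and let ${}_{r+1}\phi_r[a_1,\dots,a_{r+1};b_1,\dots,b_r;q,z]=\sum_{k\ge0}\frac{(a_1,\dots,a_{r+1};q)_k}{(q,b_1,\dots,b_r;q)_k}z^k$. A series with a numerator parameter $q^{-N}$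 (where $q$ is the base of the series) terminates: its terms with $k>N$ are $0$. Let $n\ge 0$ be an integer and let $a,b,q$ be nonzero complex numbers. (1) Let $0<|p|<1$ and suppose that $\theta(ab;p^2)$, $(q^2,aq^2,aq,apq^2,aq/p,b^2,bq^{2-2n}/a,abq^{2n+2};q^2,p^2)_n$, $\theta(aq^{2n};p)$, $(a,-b;q,p)_n$ and $(a/b;q^2,p^2)_n$ (the denominators below) are nonzero. Then the following series terminates after the term $k=n$, and $${}_{12}V_{11}(ab;b,bq,b/p,bqp,aq^2/b,a^2q^{2n},q^{-2n};q^2,p^2)=\frac{\theta(a;p)}{\theta(aq^{2n};p)}\frac{(-q,aq/b;q,p)_n}{(a,-b;q,p)_n}\frac{(abq^2;q^2,p^2)_n}{(a/b;q^2,p^2)_n}q^{-n}.$$ (2) Suppose that $1-ab$, $(q^2,aq^2,aq,b^2,bq^{2-2n}/a,abq^{2n+2};q^2)_n$, $1-aq^{2n}$, $(a,-b;q)_n$ and $(a/b;q^2)_n$ are nonzero. Then, as $p\to0$ ($p\ne0$), the left and the right side of the identity in (1) converge to the left and the right side, respectively, of $${}_8W_7(ab;b,bq,aq^2/b,a^2q^{2n},q^{-2n};q^2,bq/a)=\frac{1-a}{1-aq^{2n}}\frac{(-q,aq/b;q)_n}{(a,-b;q)_n}\frac{(abq^2;q^2)_n}{(a/b;q^2)_n}q^{-n},$$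 and this identity holds. (3) Suppose that $(q^2,b^2,aq,aq^2;q^2)_n$, $1-aq^{2n}$ and $(a,-b;q)_n$ are nonzero. Then $${}_4\phi_3[b,bq,a^2q^{2n},q^{-2n};b^2,aq,aq^2;q^2,q^2]=\frac{1-a}{1-aq^{2n}}\frac{(-q,aq/b;q)_n}{(a,-b;q)_n}b^n.$$ -/

import Mathlib

open Filter Topology

noncomputable section

namespace Elliptic

/-- The theta function `θ(a; p) = ∏_{i ≥ 0} (1 - a p^i) (1 - p^(i+1) / a)`
(used for `a ≠ 0` and `0 < |p| < 1`, where the product converges absolutely). -/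
def theta (a p : ℂ) : ℂ := ∏' i : ℕ, (1 - a * p ^ i) * (1 - p ^ (i + 1) / a)

/-- The elliptic shifted factorial `(a; q, p)_n = ∏_{j < n} θ(a q^j; p)`. -/
def ellPoch (a q p : ℂ) (n : ℕ) : ℂ := ∏ j ∈ Finset.range n, theta (a * q ^ j) p

/-- `(a₁, …, a_k; q, p)_n = (a₁; q, p)_n ⋯ (a_k; q, p)_n`. -/
def ellPochs (l : List ℂ) (q p : ℂ) (n : ℕ) : ℂ := (l.map fun a => ellPoch a q p n).prod

/-- The `k`-th term of the series `V`; the list `l` holds the parameters `a₆, …, a_{r+1}`. -/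
def ellVTerm (a₁ : ℂ) (l : List ℂ) (q p : ℂ) (k : ℕ) : ℂ :=
  theta (a₁ * q ^ (2 * k)) p / theta a₁ p *
    (ellPochs (a₁ :: l) q p k / ellPochs (q :: l.map fun x => a₁ * q / x) q p k) * q ^ k

/-- The very-well-poised elliptic hypergeometric series
`_{r+1}V_r(a₁; a₆, …, a_{r+1}; q, p)`; here `r = l.length + 4`. -/
def ellV (a₁ : ℂ) (l : List ℂ) (q p : ℂ) : ℂ := ∑' k : ℕ, ellVTerm a₁ l q p k

/-- The `q`-shifted factorial `(a; q)_n = ∏_{j < n} (1 - a q^j)`. -/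
def qPoch (a q : ℂ) (n : ℕ) : ℂ := ∏ j ∈ Finset.range n, (1 - a * q ^ j)

/-- `(a₁, …, a_k; q)_n = (a₁; q)_n ⋯ (a_k; q)_n`. -/
def qPochs (l : List ℂ) (q : ℂ) (n : ℕ) : ℂ := (l.map fun a => qPoch a q n).prod

/-- The very-well-poised basic hypergeometric series
`_{r+1}W_r(a₁; a₄, …, a_{r+1}; q, z)`; the list `l` holds `a₄, …, a_{r+1}`. -/
def qW (a₁ : ℂ) (l : List ℂ) (q z : ℂ) : ℂ :=
  ∑' k : ℕ, (1 - a₁ * q ^ (2 * k)) / (1 - a₁) *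
    (qPochs (a₁ :: l) q k / qPochs (q :: l.map fun x => a₁ * q / x) q k) * z ^ k

/-- The basic hypergeometric series `_{r+1}φ_r[a₁, …, a_{r+1}; b₁, …, b_r; q, z]`, where
`as` and `bs` list the upper and the lower parameters (`as.length = bs.length + 1`). -/
def qPhi (as bs : List ℂ) (q z : ℂ) : ℂ :=
  ∑' k : ℕ, qPochs as q k / qPochs (q :: bs) q k * z ^ k

end Elliptic

end

/-!
The elliptic identity is the inverse of a Frenkel–Turaev sum.

The analytic input is the addition formula `theta_addition` for `θ`. The Jacobi triple product
(`theta_eq_thetaSeries`) writes `θ` as a bilateral series up to a constant; splitting the double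
series of `θ(xy) θ(x/y)` by parity shows that this product is a `2 × 2` determinant in `x` and `y`
(`thetaSeries_mul_thetaSeries`), and the addition formula is the Plücker relation between such
determinants. It gives, by induction, two sums: the Frenkel–Turaev sum (`frenkelTuraev`) and the
telescoping very-well-poised series whose parameters satisfy `b c d = a` (`sum_vwp_telescoping`).
If the telescoping series also terminates, it vanishes; this says that two lower triangular
matrices are inverse to each other up to a diagonal factor (`sum_inversionTerm`,
`inversionTerm_self`).

Consider the Frenkel–Turaev sum with parameters `-a; a q / b, ± √(ab) q^k, ± q^{-k}` in base
`(q, p)`. Since `θ(x; p) θ(-x; p) = θ(x²; p²)`, the dependence on `k` combines into factorials of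
base `(q², p²)`, and the sum (`sum_innerWeight`) becomes the action of one of these matrices, for
the base `(q², p²)` and the pair `(ab, a²)`. Applying the inverse matrix gives the quadratic sum:
insert the Frenkel–Turaev sum into it and interchange the summations, and a single term survives
(`sum_quadTerm_of_isGeneric`). This requires that more theta values are nonzero than those in the
denominators of the theorem. They vanish only for countably many `a`, and both sides are continuous
in `a`, which gives the identity whenever its denominators are nonzero (`sum_quadTerm`).

Theta functions are continuous at `p = 0`, with `θ(x; 0) = 1 - x`, so that the `₈W₇` sum is the
value at `p = 0` (`quadSum_limit`). For the `₄φ₃` sum, `b` is first replaced by `b p`: by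
quasi-periodicity all powers of `p` cancel, and as `p → 0` the factors `θ(c p; p²)` tend to `1`, so
that the well-poised part disappears (`sum_balanced`).
-/

namespace Elliptic

/-! ### The theta function -/

/-- The infinite shifted factorial `(x; p)_∞ = ∏_{i ≥ 0} (1 - x p^i)`. -/
noncomputable def qPochInf (x p : ℂ) : ℂ := ∏' i : ℕ, (1 - x * p ^ i)

lemma summable_norm_mul_pow {x p : ℂ} (hp : ‖p‖ < 1) : Summable fun i : ℕ => ‖-(x * p ^ i)‖ := by
  simpa using (summable_geometric_of_lt_one (norm_nonneg p) hp).mul_left ‖x‖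

lemma multipliable_one_sub_mul_pow (x : ℂ) {p : ℂ} (hp : ‖p‖ < 1) :
    Multipliable fun i : ℕ => (1 - x * p ^ i) := by
  simpa [sub_eq_add_neg] using multipliable_one_add_of_summable (summable_norm_mul_pow (x := x) hp)

/-- Joint continuity; the point `p = 0` is included, where `(x; 0)_∞ = 1 - x`. -/
lemma continuousAt_qPochInf (x p : ℂ) (hp : ‖p‖ < 1) :
    ContinuousAt (fun z : ℂ × ℂ => qPochInf z.1 z.2) (x, p) := by
  obtain ⟨r, hr, hr1⟩ := exists_between hp
  have hr0 : 0 ≤ r := (norm_nonneg p).trans hr.le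
  have h := tendsto_tprod_one_add_of_dominated_convergence (𝓕 := 𝓝 (x, p))
    (f := fun (z : ℂ × ℂ) (i : ℕ) => -(z.1 * z.2 ^ i)) (g := fun i => -(x * p ^ i))
    (bound := fun i => (‖x‖ + 1) * r ^ i)
    ((summable_geometric_of_lt_one hr0 hr1).mul_left _)
    (fun k => by
      have : Continuous fun z : ℂ × ℂ => -(z.1 * z.2 ^ k) := by fun_prop
      exact this.tendsto (x, p))
    (by
      have h1 : ∀ᶠ z : ℂ × ℂ in 𝓝 (x, p), ‖z.1‖ < ‖x‖ + 1 :=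
        (continuous_fst.norm.tendsto (x, p)).eventually (gt_mem_nhds (by simp))
      have h2 : ∀ᶠ z : ℂ × ℂ in 𝓝 (x, p), ‖z.2‖ < r :=
        (continuous_snd.norm.tendsto (x, p)).eventually (gt_mem_nhds hr)
      filter_upwards [h1, h2] with z hz1 hz2 k
      rw [norm_neg, norm_mul, norm_pow]
      gcongr)
  simpa [ContinuousAt, qPochInf, sub_eq_add_neg] using h

lemma qPochInf_zero_right (x : ℂ) : qPochInf x 0 = 1 - x := by
  rw [qPochInf, tprod_eq_mulSingle 0]
  · simp
  · intro i hi
    simp [hi]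

lemma qPochInf_zero_left (p : ℂ) : qPochInf 0 p = 1 := by simp [qPochInf]

lemma qPochInf_eq_mul (x : ℂ) {p : ℂ} (hp : ‖p‖ < 1) :
    qPochInf x p = (1 - x) * qPochInf (x * p) p := by
  rw [qPochInf, tprod_eq_zero_mul']
  · simp only [pow_zero, mul_one, qPochInf]
    congr 2; ext i; ring
  · simpa [pow_succ', mul_assoc] using multipliable_one_sub_mul_pow (x * p) hp

lemma qPochInf_ne_zero {x p : ℂ} (hp : ‖p‖ < 1) (h : ∀ i : ℕ, x * p ^ i ≠ 1) :
    qPochInf x p ≠ 0 := by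
  have := tprod_one_add_ne_zero_of_summable (f := fun i : ℕ => -(x * p ^ i))
    (fun i => by rw [← sub_eq_add_neg, sub_ne_zero]; exact (h i).symm) (summable_norm_mul_pow hp)
  simpa [qPochInf, sub_eq_add_neg] using this

lemma norm_sq_lt_one {p : ℂ} (hp : ‖p‖ < 1) : ‖p ^ 2‖ < 1 := by
  rw [norm_pow]; exact pow_lt_one₀ (norm_nonneg _) hp two_ne_zero

lemma qPochInf_mul_neg (x : ℂ) {p : ℂ} (hp : ‖p‖ < 1) :
    qPochInf x p * qPochInf (-x) p = qPochInf (x ^ 2) (p ^ 2) := by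
  rw [qPochInf, qPochInf, ← (multipliable_one_sub_mul_pow x hp).tprod_mul
    (multipliable_one_sub_mul_pow (-x) hp), qPochInf]
  congr 1; ext i; ring

lemma qPochInf_sq_mul (x : ℂ) {p : ℂ} (hp : ‖p‖ < 1) :
    qPochInf x (p ^ 2) * qPochInf (x * p) (p ^ 2) = qPochInf x p := by
  have e1 : (fun k : ℕ => 1 - x * p ^ (2 * k)) = fun k => 1 - x * (p ^ 2) ^ k := by
    ext k; rw [pow_mul]
  have e2 : (fun k : ℕ => 1 - x * p ^ (2 * k + 1)) = fun k => 1 - (x * p) * (p ^ 2) ^ k := by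
    ext k; rw [pow_succ, pow_mul]; ring
  have := tprod_even_mul_odd (f := fun k : ℕ => 1 - x * p ^ k)
    (by rw [e1]; exact multipliable_one_sub_mul_pow _ (norm_sq_lt_one hp))
    (by rw [e2]; exact multipliable_one_sub_mul_pow _ (norm_sq_lt_one hp))
  rw [e1, e2] at this
  exact this

lemma theta_eq_qPochInf (x : ℂ) {p : ℂ} (hp : ‖p‖ < 1) :
    theta x p = qPochInf x p * qPochInf (p / x) p := by
  rw [qPochInf, qPochInf, ← (multipliable_one_sub_mul_pow x hp).tprod_mul
    (multipliable_one_sub_mul_pow (p / x) hp), theta]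
  congr 1; ext i; ring

lemma theta_zero_right (x : ℂ) : theta x 0 = 1 - x := by
  rw [theta_eq_qPochInf x (by simp), qPochInf_zero_right]
  simp [qPochInf_zero_left]

lemma theta_one (p : ℂ) : theta 1 p = 0 :=
  tprod_of_exists_eq_zero ⟨0, by simp⟩

lemma theta_inv {x p : ℂ} (hx : x ≠ 0) (hp : ‖p‖ < 1) : theta x⁻¹ p = -theta x p / x := by
  rw [theta_eq_qPochInf _ hp, theta_eq_qPochInf _ hp, qPochInf_eq_mul x⁻¹ hp, qPochInf_eq_mul x hp,
    div_inv_eq_mul, mul_comm p x, mul_comm x⁻¹ p, ← div_eq_mul_inv]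
  field_simp
  ring

lemma theta_mul_right {x p : ℂ} (hx : x ≠ 0) (hp0 : p ≠ 0) (hp : ‖p‖ < 1) :
    theta (x * p) p = -theta x p / x := by
  have : p / (x * p) = x⁻¹ := by field_simp
  rw [theta_eq_qPochInf _ hp, theta_eq_qPochInf _ hp, this, qPochInf_eq_mul x⁻¹ hp,
    qPochInf_eq_mul x hp, mul_comm x⁻¹ p, ← div_eq_mul_inv]
  field_simp
  ring

lemma theta_div_right {x p : ℂ} (hx : x ≠ 0) (hp0 : p ≠ 0) (hp : ‖p‖ < 1) :
    theta (x / p) p = -(x / p) * theta x p := by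
  have := theta_mul_right (x := x / p) (by positivity) hp0 hp
  rw [div_mul_cancel₀ _ hp0] at this
  rw [this]; field_simp

/-- `θ(x / p; p²)` and `θ(x p; p²)` differ by an elementary factor, since `x p = (x / p) p²`. -/
lemma theta_div_sq {x p : ℂ} (hx : x ≠ 0) (hp0 : p ≠ 0) (hp : ‖p‖ < 1) :
    theta (x / p) (p ^ 2) = -(x / p) * theta (x * p) (p ^ 2) := by
  have := theta_mul_right (x := x / p) (by positivity) (pow_ne_zero 2 hp0) (norm_sq_lt_one hp)
  rw [show x / p * p ^ 2 = x * p by field_simp] at this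
  rw [this]; field_simp

lemma theta_mul_theta_neg (x : ℂ) {p : ℂ} (hp : ‖p‖ < 1) :
    theta x p * theta (-x) p = theta (x ^ 2) (p ^ 2) := by
  rw [theta_eq_qPochInf _ hp, theta_eq_qPochInf _ hp, theta_eq_qPochInf _ (norm_sq_lt_one hp),
    ← qPochInf_mul_neg _ hp, ← div_pow, ← qPochInf_mul_neg _ hp, div_neg]
  ring

lemma theta_sq_mul {x p : ℂ} (hp0 : p ≠ 0) (hp : ‖p‖ < 1) :
    theta x (p ^ 2) * theta (x * p) (p ^ 2) = theta x p := by
  rw [theta_eq_qPochInf _ hp, theta_eq_qPochInf _ (norm_sq_lt_one hp),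
    theta_eq_qPochInf _ (norm_sq_lt_one hp), ← qPochInf_sq_mul _ hp, ← qPochInf_sq_mul (p / x) hp,
    show p ^ 2 / (x * p) = p / x by field_simp, show p / x * p = p ^ 2 / x by ring]
  ring

lemma theta_ne_zero {x p : ℂ} (hx : x ≠ 0) (hp0 : p ≠ 0) (hp : ‖p‖ < 1)
    (h : ∀ m : ℤ, x ≠ p ^ m) : theta x p ≠ 0 := by
  rw [theta_eq_qPochInf _ hp]
  refine mul_ne_zero (qPochInf_ne_zero hp fun i hi => h (-i) ?_)
    (qPochInf_ne_zero hp fun i hi => h (i + 1) ?_)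
  · rw [zpow_neg, zpow_natCast, eq_inv_of_mul_eq_one_left hi]
  · rw [div_mul_eq_mul_div, div_eq_one_iff_eq hx] at hi
    rw [← hi, zpow_add₀ hp0, zpow_natCast, zpow_one, mul_comm]

/-- Continuity of `theta` along functions; `p = 0` is allowed. -/
lemma _root_.ContinuousAt.theta {X : Type*} [TopologicalSpace X] {f g : X → ℂ} {t : X}
    (hf : ContinuousAt f t) (hg : ContinuousAt g t) (h0 : f t ≠ 0) (h1 : ‖g t‖ < 1) :
    ContinuousAt (fun s => theta (f s) (g s)) t := by
  have h : ContinuousAt (fun s => qPochInf (f s) (g s) * qPochInf (g s / f s) (g s)) t := by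
    refine ContinuousAt.mul ?_ ?_
    · exact ContinuousAt.comp (f := fun s => (f s, g s)) (g := fun z : ℂ × ℂ => qPochInf z.1 z.2)
        (continuousAt_qPochInf _ _ h1) (hf.prodMk hg)
    · exact ContinuousAt.comp (f := fun s => (g s / f s, g s))
        (g := fun z : ℂ × ℂ => qPochInf z.1 z.2)
        (continuousAt_qPochInf _ _ h1) ((hg.div hf h0).prodMk hg)
  refine h.congr ?_
  have : ∀ᶠ s in 𝓝 t, ‖g s‖ < 1 := hg.norm.eventually (gt_mem_nhds h1)
  filter_upwards [this] with s hs using (theta_eq_qPochInf _ hs).symm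

/-- In base `p²` the argument `c p` lies strictly inside the fundamental annulus, so that the theta
function tends to `1`. -/
lemma tendsto_theta_mul_sq (c : ℂ) (hc : c ≠ 0) :
    Tendsto (fun p : ℂ => theta (c * p) (p ^ 2)) (𝓝[≠] 0) (𝓝 1) := by
  have h : ContinuousAt (fun p : ℂ => qPochInf (c * p) (p ^ 2) * qPochInf (p / c) (p ^ 2)) 0 := by
    refine ContinuousAt.mul ?_ ?_
    · exact ContinuousAt.comp (f := fun p : ℂ => (c * p, p ^ 2))
        (g := fun z : ℂ × ℂ => qPochInf z.1 z.2)
        (continuousAt_qPochInf _ _ (by simp)) (by fun_prop)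
    · exact ContinuousAt.comp (f := fun p : ℂ => (p / c, p ^ 2))
        (g := fun z : ℂ × ℂ => qPochInf z.1 z.2)
        (continuousAt_qPochInf _ _ (by simp)) (by fun_prop)
  have h2 := h.tendsto.mono_left (nhdsWithin_le_nhds (s := {0}ᶜ))
  simp only [mul_zero, zero_div, qPochInf_zero_left, mul_one] at h2
  refine h2.congr' ?_
  have : ∀ᶠ p : ℂ in 𝓝[≠] 0, ‖p‖ < 1 :=
    ((continuous_norm.tendsto (0 : ℂ)).mono_left nhdsWithin_le_nhds).eventually
      (gt_mem_nhds (by simp))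
  filter_upwards [this, self_mem_nhdsWithin] with p hp hp0
  rw [theta_eq_qPochInf _ (norm_sq_lt_one hp)]
  congr 2
  have : p ≠ 0 := hp0
  field_simp

/-! ### The Laurent expansion of the theta function -/

/-- The triangular number `m (m - 1) / 2` for an integer `m`. -/
def tri (m : ℤ) : ℤ := m * (m - 1) / 2

lemma two_mul_tri (m : ℤ) : 2 * tri m = m * (m - 1) :=
  Int.mul_ediv_cancel' (Int.even_mul_pred_self m).two_dvd

lemma tri_add_one (m : ℤ) : tri (m + 1) = tri m + m := by
  have h1 := two_mul_tri m
  have h2 := two_mul_tri (m + 1)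
  have : 2 * tri (m + 1) = 2 * (tri m + m) := by rw [h2, mul_add, h1]; ring
  omega

lemma zpow_tri_add_one {p : ℂ} (hp0 : p ≠ 0) (m : ℤ) :
    p ^ tri (m + 1) = p ^ tri m * p ^ m := by
  rw [tri_add_one, zpow_add₀ hp0]

/-- The bilateral series `∑ p^{m(m-1)/2} x^m`, which represents `θ(-x; p)` up to a constant. -/
noncomputable def thetaSeries (x p : ℂ) : ℂ := ∑' m : ℤ, p ^ tri m * x ^ m

lemma summable_norm_thetaSeries_nat {x p : ℂ} (hx : x ≠ 0) (hp0 : p ≠ 0) (hp : ‖p‖ < 1) :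
    Summable fun n : ℕ => ‖p ^ tri n * x ^ (n : ℤ)‖ := by
  refine summable_of_ratio_test_tendsto_lt_one (l := 0) one_pos
    (Eventually.of_forall fun n => by
      rw [norm_ne_zero_iff]; exact mul_ne_zero (zpow_ne_zero _ hp0) (zpow_ne_zero _ hx)) ?_
  have h : Tendsto (fun n : ℕ => ‖p‖ ^ n * ‖x‖) atTop (𝓝 (0 * ‖x‖)) :=
    (tendsto_pow_atTop_nhds_zero_of_lt_one (norm_nonneg p) hp).mul_const _
  rw [zero_mul] at h
  refine h.congr fun n => ?_
  have e1 := norm_pos_iff.mpr (zpow_ne_zero (tri n) hp0)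
  have e2 := norm_pos_iff.mpr (zpow_ne_zero n hx)
  rw [Nat.cast_succ, zpow_tri_add_one hp0, zpow_add_one₀ hx]
  simp only [norm_norm, norm_mul, zpow_natCast, norm_pow] at *
  field_simp

lemma summable_norm_thetaSeries {x p : ℂ} (hx : x ≠ 0) (hp0 : p ≠ 0) (hp : ‖p‖ < 1) :
    Summable fun m : ℤ => ‖p ^ tri m * x ^ m‖ := by
  refine Summable.of_nat_of_neg (summable_norm_thetaSeries_nat hx hp0 hp) ?_
  refine (summable_norm_thetaSeries_nat (x := p / x) (by positivity) hp0 hp).congr fun n => ?_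
  have : tri (-n) = tri n + n := by
    have h1 := two_mul_tri n
    have h2 := two_mul_tri (-n)
    have : 2 * tri (-n) = 2 * (tri n + n) := by rw [h2, mul_add, h1]; ring
    omega
  rw [this, zpow_add₀ hp0, div_zpow, zpow_neg]
  congr 1
  ring

lemma hasSum_thetaSeries {x p : ℂ} (hx : x ≠ 0) (hp0 : p ≠ 0) (hp : ‖p‖ < 1) :
    HasSum (fun m : ℤ => p ^ tri m * x ^ m) (thetaSeries x p) :=
  (summable_norm_thetaSeries hx hp0 hp).of_norm.hasSum

lemma thetaSeries_eq_mul {x p : ℂ} (hx : x ≠ 0) (hp0 : p ≠ 0) :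
    thetaSeries x p = x * thetaSeries (x * p) p := by
  rw [thetaSeries, ← (Equiv.addRight (1 : ℤ)).tsum_eq, thetaSeries, ← tsum_mul_left]
  congr 1; ext m
  simp only [Equiv.coe_addRight]
  rw [zpow_tri_add_one hp0, zpow_add_one₀ hx, mul_zpow]
  ring

/-- `1 / (p; p)_i`, extended by `0` to negative `i`. -/
noncomputable def invPoch (p : ℂ) (i : ℤ) : ℂ := if i < 0 then 0 else (qPoch p p i.toNat)⁻¹

lemma one_sub_pow_ne_zero {p : ℂ} (hp : ‖p‖ < 1) (n : ℕ) : 1 - p ^ (n + 1) ≠ 0 := by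
  intro h
  have h1 : ‖p ^ (n + 1)‖ = 1 := by rw [← sub_eq_zero.mp h]; simp
  rw [norm_pow] at h1
  exact (pow_lt_one₀ (norm_nonneg _) hp (Nat.succ_ne_zero n)).ne h1

lemma qPoch_self_ne_zero {p : ℂ} (hp : ‖p‖ < 1) (n : ℕ) : qPoch p p n ≠ 0 :=
  Finset.prod_ne_zero_iff.mpr fun j _ => by
    rw [← pow_succ']; exact one_sub_pow_ne_zero hp j

/-- Thanks to the extension by `0`, the recurrence holds for all integers. -/
lemma invPoch_sub_one {p : ℂ} (hp : ‖p‖ < 1) (i : ℤ) :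
    invPoch p (i - 1) = invPoch p i * (1 - p ^ i) := by
  rcases lt_trichotomy i 0 with h | rfl | h
  · simp [invPoch, h, show i - 1 < 0 by omega]
  · simp [invPoch]
  · obtain ⟨n, rfl⟩ : ∃ n : ℕ, i = n + 1 := ⟨(i - 1).toNat, by omega⟩
    have h1 : ((n : ℤ) + 1).toNat = n + 1 := by omega
    have h2 := qPoch_self_ne_zero hp n
    have h3 := one_sub_pow_ne_zero hp n
    have h4 : qPoch p p (n + 1) = qPoch p p n * (1 - p ^ (n + 1)) := by
      rw [qPoch, Finset.prod_range_succ, ← pow_succ', qPoch]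
    rw [invPoch, invPoch, if_neg (by omega), if_neg (by omega), h1, h4,
      show ((n : ℤ) + 1 - 1).toNat = n by omega,
      show p ^ ((n : ℤ) + 1) = p ^ (n + 1) by exact_mod_cast zpow_natCast p (n + 1)]
    field_simp

lemma _root_.HasSum.of_eq {ι M : Type*} [AddCommMonoid M] [TopologicalSpace M] {f g : ι → M}
    {s t : M} (h : HasSum f s) (hfg : ∀ i, g i = f i) (hst : t = s) : HasSum g t := by
  rw [hst, funext hfg]
  exact h

/-- The finite form of the Jacobi triple product. -/
lemma hasSum_finite_triple_product {x p : ℂ} (hx : x ≠ 0) (hp0 : p ≠ 0) (hp : ‖p‖ < 1) (n : ℕ) :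
    HasSum (fun m : ℤ => qPoch p p (2 * n) * invPoch p (n + m) * invPoch p (n - m) *
        (p ^ tri m * (-x) ^ m))
      (∏ i ∈ Finset.range n, (1 - x * p ^ i) * (1 - p ^ (i + 1) / x)) := by
  have hx' : -x ≠ 0 := neg_ne_zero.mpr hx
  induction n with
  | zero =>
    have := hasSum_ite_eq (0 : ℤ) (1 : ℂ)
    simp only [Finset.range_zero, Finset.prod_empty]
    refine this.of_eq (fun m => ?_) rfl
    rcases lt_trichotomy m 0 with h | rfl | h
    · simp [invPoch, h, h.ne]
    · simp [invPoch, qPoch, tri]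
    · simp [invPoch, h, h.ne']
  | succ n ih =>
    rw [Finset.prod_range_succ]
    have s1 := ih.mul_right (1 + p ^ (2 * n + 1))
    have s2 := ((Equiv.subRight (1 : ℤ)).hasSum_iff.mpr ih).mul_right (-x * p ^ n)
    have s3 := ((Equiv.addRight (1 : ℤ)).hasSum_iff.mpr ih).mul_right (-(p ^ (n + 1) / x))
    refine ((s1.add s2).add s3).of_eq (fun m => ?_) ?_
    · have h1 : invPoch p (n + m) = invPoch p (n + 1 + m) * (1 - p ^ (n + 1 + m)) := by
        rw [← invPoch_sub_one hp]; congr 1; ring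
      have h2 : invPoch p (n + (m - 1)) =
          invPoch p (n + 1 + m) * (1 - p ^ (n + 1 + m)) * (1 - p ^ (n + m)) := by
        rw [← h1, ← invPoch_sub_one hp]; congr 1; ring
      have h3 : invPoch p (n - m) = invPoch p (n + 1 - m) * (1 - p ^ (n + 1 - m)) := by
        rw [← invPoch_sub_one hp]; congr 1; ring
      have h4 : invPoch p (n - (m + 1)) =
          invPoch p (n + 1 - m) * (1 - p ^ (n + 1 - m)) * (1 - p ^ (n - m)) := by
        rw [← h3, ← invPoch_sub_one hp]; congr 1; ring
      have h5 : invPoch p (n - (m - 1)) = invPoch p (n + 1 - m) := by congr 1; ring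
      have h6 : invPoch p (n + (m + 1)) = invPoch p (n + 1 + m) := by congr 1; ring
      have h7 : qPoch p p (2 * (n + 1)) =
          qPoch p p (2 * n) * (1 - p ^ (2 * n + 1)) * (1 - p ^ (2 * n + 2)) := by
        rw [show 2 * (n + 1) = 2 * n + 1 + 1 by ring, qPoch, Finset.prod_range_succ,
          Finset.prod_range_succ, qPoch]
        ring
      have h8 : p ^ tri m = p ^ tri (m - 1) * (p ^ m / p) := by
        have := zpow_tri_add_one hp0 (m - 1)
        rwa [sub_add_cancel, zpow_sub_one₀ hp0] at this
      simp only [Function.comp, Equiv.coe_addRight, Equiv.subRight_apply, Nat.cast_succ]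
      rw [h1, h2, h3, h4, h5, h6, h7, zpow_tri_add_one hp0, h8, zpow_sub_one₀ hx',
        zpow_add_one₀ hx']
      simp only [zpow_add₀ hp0, zpow_sub₀ hp0, zpow_natCast, zpow_one, pow_add, pow_mul']
      have hv : p ^ m ≠ 0 := zpow_ne_zero m hp0
      field_simp
      ring
    · field_simp
      ring

lemma tendsto_qPoch_self {p : ℂ} (hp : ‖p‖ < 1) :
    Tendsto (qPoch p p) atTop (𝓝 (qPochInf p p)) :=
  (multipliable_one_sub_mul_pow p hp).hasProd.tendsto_prod_nat

lemma qPochInf_self_ne_zero {p : ℂ} (hp : ‖p‖ < 1) : qPochInf p p ≠ 0 :=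
  qPochInf_ne_zero hp fun i hi => one_sub_pow_ne_zero hp i (by rw [pow_succ', hi, sub_self])

lemma tendsto_invPoch {p : ℂ} (hp : ‖p‖ < 1) (m : ℤ) :
    Tendsto (fun n : ℕ => invPoch p (n + m)) atTop (𝓝 (qPochInf p p)⁻¹) := by
  have h : Tendsto (fun n : ℕ => (qPoch p p ((n : ℤ) + m).toNat)⁻¹) atTop (𝓝 (qPochInf p p)⁻¹) := by
    refine (((tendsto_qPoch_self hp).comp ?_).inv₀ (qPochInf_self_ne_zero hp))
    refine tendsto_atTop.mpr fun b => ?_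
    filter_upwards [eventually_ge_atTop (b + m.natAbs)] with n hn
    omega
  refine h.congr' ?_
  filter_upwards [eventually_ge_atTop m.natAbs] with n hn
  rw [invPoch, if_neg (by omega)]

lemma exists_norm_invPoch_le {p : ℂ} (hp : ‖p‖ < 1) : ∃ K, ∀ i : ℤ, ‖invPoch p i‖ ≤ K := by
  have h := ((tendsto_qPoch_self hp).inv₀ (qPochInf_self_ne_zero hp)).norm.bddAbove_range
  obtain ⟨K, hK⟩ := h
  have hK' : ∀ n, ‖(qPoch p p n)⁻¹‖ ≤ K := fun n => hK ⟨n, rfl⟩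
  refine ⟨K, fun i => ?_⟩
  rw [invPoch]
  split_ifs
  · simpa using (norm_nonneg _).trans (hK' 0)
  · exact hK' _

/-- The Jacobi triple product, obtained from its finite form by dominated convergence. -/
lemma theta_eq_thetaSeries {x p : ℂ} (hx : x ≠ 0) (hp0 : p ≠ 0) (hp : ‖p‖ < 1) :
    theta x p = (qPochInf p p)⁻¹ * thetaSeries (-x) p := by
  have hx' : -x ≠ 0 := neg_ne_zero.mpr hx
  obtain ⟨K, hK⟩ := exists_norm_invPoch_le hp
  have hK0 : 0 ≤ K := (norm_nonneg _).trans (hK 0)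
  obtain ⟨K₁, hK₁⟩ := (tendsto_qPoch_self hp).norm.bddAbove_range
  have hK₁' : ∀ n, ‖qPoch p p n‖ ≤ K₁ := fun n => hK₁ ⟨n, rfl⟩
  have h1 : Tendsto (fun n => ∏ i ∈ Finset.range n, (1 - x * p ^ i) * (1 - p ^ (i + 1) / x)) atTop
      (𝓝 (theta x p)) := by
    refine Multipliable.tendsto_prod_tprod_nat ?_
    have := (multipliable_one_sub_mul_pow x hp).mul (multipliable_one_sub_mul_pow (p / x) hp)
    refine this.congr fun i => ?_
    ring
  have h2 := tendsto_tsum_of_dominated_convergence (𝓕 := atTop)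
    (f := fun (n : ℕ) (m : ℤ) => qPoch p p (2 * n) * invPoch p (n + m) * invPoch p (n - m) *
        (p ^ tri m * (-x) ^ m))
    (g := fun m => (qPochInf p p)⁻¹ * (p ^ tri m * (-x) ^ m))
    ((summable_norm_thetaSeries hx' hp0 hp).mul_left (K₁ * K * K))
    (fun m => by
      have e1 := (tendsto_qPoch_self hp).comp
        (tendsto_id.const_mul_atTop' (r := 2) two_pos)
      have e2 := (e1.mul (tendsto_invPoch hp m)).mul (tendsto_invPoch hp (-m))
      have := e2.mul_const (p ^ tri m * (-x) ^ m)
      simpa [sub_eq_add_neg, qPochInf_self_ne_zero hp] using this)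
    (Eventually.of_forall fun n m => by
      rw [norm_mul, norm_mul, norm_mul]
      have hK₁0 : 0 ≤ K₁ := (norm_nonneg _).trans (hK₁' 0)
      gcongr
      · exact hK₁' _
      · exact hK _
      · exact hK _)
  rw [thetaSeries, ← tsum_mul_left]
  refine tendsto_nhds_unique h1 (h2.congr fun n => ?_)
  exact (hasSum_finite_triple_product hx hp0 hp n).tsum_eq

/-! ### The addition formula -/

lemma tri_add_mul_tri_sub {p : ℂ} (hp0 : p ≠ 0) (i j : ℤ) :
    p ^ tri (i + j) * p ^ tri (i - j) = (p ^ 2) ^ tri i * ((p ^ 2) ^ tri j * p ^ j) := by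
  have e : tri (i + j) + tri (i - j) = 2 * tri i + (2 * tri j + j) := by
    have a1 := two_mul_tri (i + j)
    have a2 := two_mul_tri (i - j)
    have a3 := two_mul_tri i
    have a4 := two_mul_tri j
    have : 2 * (tri (i + j) + tri (i - j)) = 2 * (2 * tri i + (2 * tri j + j)) := by
      rw [mul_add, a1, a2, a3, a4]; ring
    omega
  have hsq : ∀ m : ℤ, (p ^ 2) ^ m = p ^ (2 * m) := fun m => by
    rw [zpow_mul]; rfl
  rw [← zpow_add₀ hp0, e, zpow_add₀ hp0, zpow_add₀ hp0, hsq, hsq]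

lemma hasSum_thetaSeries_mul {x y p : ℂ} (hx : x ≠ 0) (hy : y ≠ 0) (hp0 : p ≠ 0) (hp : ‖p‖ < 1) :
    HasSum (fun z : ℤ × ℤ => (p ^ tri z.1 * x ^ z.1) * (p ^ tri z.2 * y ^ z.2))
      (thetaSeries x p * thetaSeries y p) := by
  have hs := summable_mul_of_summable_norm (summable_norm_thetaSeries hx hp0 hp)
    (summable_norm_thetaSeries hy hp0 hp)
  have h := (hasSum_thetaSeries hx hp0 hp).mul (hasSum_thetaSeries hy hp0 hp) hs
  exact h

lemma isCompl_range_add_sub :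
    IsCompl (Set.range fun z : ℤ × ℤ => (z.1 + z.2, z.1 - z.2))
      (Set.range fun z : ℤ × ℤ => (z.1 + z.2 + 1, z.1 - z.2)) := by
  constructor
  · rw [Set.disjoint_left]
    rintro _ ⟨⟨i, j⟩, rfl⟩ ⟨⟨i', j'⟩, h⟩
    simp only [Prod.mk.injEq] at h
    omega
  · rw [codisjoint_iff_le_sup]
    rintro ⟨m, n⟩ -
    rcases Int.even_or_odd' (m + n) with ⟨i, hi | hi⟩
    · exact Or.inl ⟨(i, m - i), by simp only [Prod.mk.injEq]; omega⟩
    · exact Or.inr ⟨(i, m - i - 1), by simp only [Prod.mk.injEq]; omega⟩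

/-- Splitting the double series for `θ(x y) θ(x / y)` according to the parity of the exponents
shows that it is a `2 × 2` determinant in `x` and `y`. -/
lemma thetaSeries_mul_thetaSeries {x y p : ℂ} (hx : x ≠ 0) (hy : y ≠ 0) (hp0 : p ≠ 0)
    (hp : ‖p‖ < 1) :
    thetaSeries (-(x * y)) p * thetaSeries (-(x / y)) p =
      thetaSeries (x ^ 2) (p ^ 2) * thetaSeries (p * y ^ 2) (p ^ 2) -
        x / y * (thetaSeries (p * x ^ 2) (p ^ 2) * thetaSeries (y ^ 2) (p ^ 2)) := by
  have hxy : -(x * y) ≠ 0 := neg_ne_zero.mpr (mul_ne_zero hx hy)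
  have hxy' : -(x / y) ≠ 0 := neg_ne_zero.mpr (div_ne_zero hx hy)
  have hP0 : p ^ 2 ≠ 0 := pow_ne_zero 2 hp0
  have hx2 : x ^ 2 ≠ 0 := pow_ne_zero 2 hx
  have hy2 : y ^ 2 ≠ 0 := pow_ne_zero 2 hy
  have hP := norm_sq_lt_one hp
  have hf := hasSum_thetaSeries_mul hxy hxy' hp0 hp
  have hexp : ∀ i j : ℤ, (-(x * y)) ^ (i + j) * (-(x / y)) ^ (i - j) =
      (x ^ 2) ^ i * (y ^ 2) ^ j := by
    intro i j
    rw [zpow_add₀ hxy, zpow_sub₀ hxy']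
    have b1 : (-(x * y)) ^ i * (-(x / y)) ^ i = (x ^ 2) ^ i := by
      rw [← mul_zpow]; congr 1; field_simp
    have b2 : (-(x * y)) ^ j / (-(x / y)) ^ j = (y ^ 2) ^ j := by
      rw [← div_zpow]; congr 1; field_simp
    rw [← b1, ← b2]; ring
  have hg₁ : Function.Injective fun z : ℤ × ℤ => (z.1 + z.2, z.1 - z.2) := by
    rintro ⟨i, j⟩ ⟨i', j'⟩ h
    simp only [Prod.mk.injEq] at h ⊢
    omega
  have hg₂ : Function.Injective fun z : ℤ × ℤ => (z.1 + z.2 + 1, z.1 - z.2) := by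
    rintro ⟨i, j⟩ ⟨i', j'⟩ h
    simp only [Prod.mk.injEq] at h ⊢
    omega
  have h1 := (hasSum_thetaSeries_mul hx2 (mul_ne_zero hp0 hy2) hP0 hP).of_eq
    (g := (fun z : ℤ × ℤ => (p ^ tri z.1 * (-(x * y)) ^ z.1) * (p ^ tri z.2 * (-(x / y)) ^ z.2)) ∘
      fun z => (z.1 + z.2, z.1 - z.2))
    (fun ⟨i, j⟩ => by
      simp only [Function.comp, mul_zpow p]
      rw [mul_mul_mul_comm, hexp, tri_add_mul_tri_sub hp0]
      ring) rfl
  have h2 := ((hasSum_thetaSeries_mul (mul_ne_zero hp0 hx2) (mul_ne_zero hy2 hP0)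
      hP0 hP).mul_left (-(x * y))).of_eq
    (g := (fun z : ℤ × ℤ => (p ^ tri z.1 * (-(x * y)) ^ z.1) * (p ^ tri z.2 * (-(x / y)) ^ z.2)) ∘
      fun z => (z.1 + z.2 + 1, z.1 - z.2))
    (fun ⟨i, j⟩ => by
      simp only [Function.comp, mul_zpow p, mul_zpow (y ^ 2)]
      rw [mul_mul_mul_comm, zpow_add_one₀ hxy, zpow_tri_add_one hp0, mul_right_comm (p ^ _),
        mul_right_comm ((-(x * y)) ^ _), hexp, tri_add_mul_tri_sub hp0, zpow_add₀ hp0,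
        show (p ^ 2) ^ j = p ^ j * p ^ j by rw [← mul_zpow, sq]]
      ring) rfl
  have h3 := HasSum.add_isCompl isCompl_range_add_sub (hg₁.hasSum_range_iff.mpr h1)
    (hg₂.hasSum_range_iff.mpr h2)
  rw [hf.unique h3, thetaSeries_eq_mul hy2 hP0]
  field_simp
  ring

/-- The Weierstrass addition formula for the theta function: by
`thetaSeries_mul_thetaSeries` it is a Plücker relation between `2 × 2` minors. -/
lemma theta_addition {x y u v p : ℂ} (hx : x ≠ 0) (hy : y ≠ 0) (hu : u ≠ 0) (hv : v ≠ 0)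
    (hp0 : p ≠ 0) (hp : ‖p‖ < 1) :
    theta (x * y) p * theta (x / y) p * (theta (u * v) p * theta (u / v) p) -
      theta (x * v) p * theta (x / v) p * (theta (u * y) p * theta (u / y) p) =
      u / y * (theta (y * v) p * theta (y / v) p * (theta (x * u) p * theta (x / u) p)) := by
  have key : ∀ {s t : ℂ}, s ≠ 0 → t ≠ 0 → theta (s * t) p * theta (s / t) p =
      (qPochInf p p)⁻¹ ^ 2 * (thetaSeries (s ^ 2) (p ^ 2) * thetaSeries (p * t ^ 2) (p ^ 2) -
        s / t * (thetaSeries (p * s ^ 2) (p ^ 2) * thetaSeries (t ^ 2) (p ^ 2))) := by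
    intro s t hs ht
    rw [← thetaSeries_mul_thetaSeries hs ht hp0 hp,
      theta_eq_thetaSeries (mul_ne_zero hs ht) hp0 hp,
      theta_eq_thetaSeries (div_ne_zero hs ht) hp0 hp]
    ring
  rw [key hx hy, key hu hv, key hx hv, key hu hy, key hy hv, key hx hu]
  field_simp
  ring

/-- The addition formula after the substitution `(x, y, u, v) = (s X, Y / s, s U, V / s)` with
`s² = a`, which is free of square roots. -/
lemma theta_addition_wellPoised {a X Y U V p : ℂ} (ha : a ≠ 0) (hX : X ≠ 0) (hY : Y ≠ 0)
    (hU : U ≠ 0) (hV : V ≠ 0) (hp0 : p ≠ 0) (hp : ‖p‖ < 1) :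
    theta (X * Y) p * theta (a * X / Y) p * (theta (U * V) p * theta (a * U / V) p) -
      theta (X * V) p * theta (a * X / V) p * (theta (U * Y) p * theta (a * U / Y) p) =
      a * U / Y * (theta (Y * V / a) p * theta (Y / V) p *
        (theta (a * X * U) p * theta (X / U) p)) := by
  obtain ⟨s, hs⟩ := IsAlgClosed.exists_pow_nat_eq a (n := 2) two_pos
  have hs0 : s ≠ 0 := by rintro rfl; simp at hs; exact ha hs.symm
  have h := theta_addition (x := s * X) (y := Y / s) (u := s * U) (v := V / s) (by positivity)
    (by positivity) (by positivity) (by positivity) hp0 hp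
  subst hs
  have e : ∀ A B : ℂ, s * A * (B / s) = A * B := fun A B => by field_simp
  have e' : ∀ A B : ℂ, s * A / (B / s) = s ^ 2 * A / B := fun A B => by field_simp
  simp only [e, e'] at h
  rw [h, show Y / s * (V / s) = Y * V / s ^ 2 by field_simp,
    show Y / s / (V / s) = Y / V by field_simp, show s * X * (s * U) = s ^ 2 * X * U by ring,
    show s * X / (s * U) = X / U by field_simp]

/-! ### Elliptic shifted factorials -/

lemma ellPoch_zero (x q p : ℂ) : ellPoch x q p 0 = 1 := by simp [ellPoch]

lemma ellPoch_succ (x q p : ℂ) (n : ℕ) :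
    ellPoch x q p (n + 1) = ellPoch x q p n * theta (x * q ^ n) p :=
  Finset.prod_range_succ _ _

lemma ellPoch_succ' (x q p : ℂ) (n : ℕ) :
    ellPoch x q p (n + 1) = theta x p * ellPoch (x * q) q p n := by
  rw [ellPoch, Finset.prod_range_succ', mul_comm, ellPoch]
  simp [pow_succ', mul_assoc]

lemma ellPoch_add (x q p : ℂ) (m n : ℕ) :
    ellPoch x q p (m + n) = ellPoch x q p m * ellPoch (x * q ^ m) q p n := by
  rw [ellPoch, Finset.prod_range_add]
  simp [ellPoch, pow_add, mul_assoc]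

lemma ellPoch_ne_zero {x q p : ℂ} {n : ℕ} (h : ∀ j < n, theta (x * q ^ j) p ≠ 0) :
    ellPoch x q p n ≠ 0 :=
  Finset.prod_ne_zero_iff.mpr fun j hj => h j (Finset.mem_range.mp hj)

lemma theta_ne_zero_of_ellPoch {x q p : ℂ} {n : ℕ} (h : ellPoch x q p n ≠ 0) {j : ℕ} (hj : j < n) :
    theta (x * q ^ j) p ≠ 0 :=
  Finset.prod_ne_zero_iff.mp h j (Finset.mem_range.mpr hj)

lemma ellPoch_ne_zero_of_le {x q p : ℂ} {n : ℕ} (h : ellPoch x q p n ≠ 0) {k : ℕ} (hk : k ≤ n) :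
    ellPoch x q p k ≠ 0 :=
  ellPoch_ne_zero fun _ hj => theta_ne_zero_of_ellPoch h (hj.trans_le hk)

lemma ellPoch_eq_zero {x q p : ℂ} {m n : ℕ} (h : x * q ^ m = 1) (hm : m < n) :
    ellPoch x q p n = 0 :=
  Finset.prod_eq_zero (Finset.mem_range.mpr hm) (by rw [h, theta_one])

lemma ellPoch_mul_neg (x q : ℂ) {p : ℂ} (hp : ‖p‖ < 1) (n : ℕ) :
    ellPoch x q p n * ellPoch (-x) q p n = ellPoch (x ^ 2) (q ^ 2) (p ^ 2) n := by
  rw [ellPoch, ellPoch, ← Finset.prod_mul_distrib, ellPoch]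
  refine Finset.prod_congr rfl fun j _ => ?_
  rw [neg_mul, theta_mul_theta_neg _ hp]
  congr 1; ring

lemma ellPoch_sq_mul (x q : ℂ) {p : ℂ} (n : ℕ) :
    ellPoch x (q ^ 2) p n * ellPoch (x * q) (q ^ 2) p n = ellPoch x q p (2 * n) := by
  induction n with
  | zero => simp [ellPoch_zero]
  | succ n ih =>
    rw [show 2 * (n + 1) = 2 * n + 1 + 1 by ring, ellPoch_succ, ellPoch_succ, ellPoch_succ,
      ellPoch_succ, ← ih, show x * (q ^ 2) ^ n = x * q ^ (2 * n) by ring,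
      show x * q * (q ^ 2) ^ n = x * q ^ (2 * n + 1) by ring]
    ring

/-- Multiplying every theta factor by an elementary factor `c q^j`. -/
lemma prod_const_mul_pow (c q : ℂ) (n : ℕ) :
    ∏ j ∈ Finset.range n, (c * q ^ j) = c ^ n * q ^ n.choose 2 := by
  induction n with
  | zero => simp
  | succ n ih =>
    rw [Finset.prod_range_succ, ih, show (n + 1).choose 2 = n + n.choose 2 by
      rw [Nat.choose_succ_succ' n 1, Nat.choose_one_right], pow_succ, pow_add]
    ring

/-- Reversing the order of the factors and inverting each argument. -/
lemma ellPoch_reflect {x y q p : ℂ} {n : ℕ} (hx : x ≠ 0) (hq : q ≠ 0) (hp : ‖p‖ < 1)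
    (h : x * y * q ^ n = q) :
    ellPoch y q p n = (-y) ^ n * q ^ n.choose 2 * ellPoch x q p n := by
  rw [← prod_const_mul_pow, ellPoch, ellPoch,
    ← Finset.prod_range_reflect (fun j => theta (x * q ^ j) p), ← Finset.prod_mul_distrib]
  refine Finset.prod_congr rfl fun j hj => ?_
  have hj' := Finset.mem_range.mp hj
  have e : y * q ^ j = (x * q ^ (n - 1 - j))⁻¹ := by
    refine eq_inv_of_mul_eq_one_left ?_
    apply mul_right_cancel₀ hq
    rw [one_mul]
    calc y * q ^ j * (x * q ^ (n - 1 - j)) * q = x * y * (q ^ j * q ^ (n - 1 - j) * q ^ 1) := by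
          ring
      _ = q := by
          rw [← pow_add, ← pow_add, show j + (n - 1 - j) + 1 = n by omega, h]
  rw [neg_mul, e, theta_inv (by positivity) hp]
  ring

/-! ### The Frenkel–Turaev sum -/

/-- The `k`-th term of a very-well-poised series with five free parameters. -/
noncomputable def vwpTerm (a b c d e f q p : ℂ) (k : ℕ) : ℂ :=
  theta (a * q ^ (2 * k)) p / theta a p *
    (ellPoch a q p k * ellPoch b q p k * ellPoch c q p k * ellPoch d q p k * ellPoch e q p k *
        ellPoch f q p k /
      (ellPoch q q p k * ellPoch (a * q / b) q p k * ellPoch (a * q / c) q p k *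
        ellPoch (a * q / d) q p k * ellPoch (a * q / e) q p k * ellPoch (a * q / f) q p k)) * q ^ k

lemma vwpTerm_zero {a b c d e f q p : ℂ} (ha : theta a p ≠ 0) :
    vwpTerm a b c d e f q p 0 = 1 := by
  simp [vwpTerm, ellPoch_zero, ha]

/-- The coefficient in `vwpTerm_succ` of the term with `a` replaced by `a q²`. -/
noncomputable def vwpCoeff (a b c d e V q p : ℂ) : ℂ :=
  q * (a / e) * theta (a * q) p * theta (a * q ^ 2) p * theta b p * theta c p * theta d p *
    theta (e * V / a) p * theta (e / V) p /
    (theta (a * q / b) p * theta (a * q / c) p * theta (a * q / d) p * theta (a * q / e) p *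
      theta (a / e) p * theta (a / V) p * theta (a * q / V) p)

/-- The field arithmetic of `vwpTerm_succ`, with one variable for each theta value. -/
lemma vwp_split_algebra {a e q K A Bn Cn Dn En Fn Q Bd Cd Dd Ed Vd ta ta1 ta2 tb tc td te tV tX taX
      t2 x1 x2 x3 x4 x5 x6 x7 x8 x9 x12 x13 x14 x16 : ℂ}
    (h6 : x6 ≠ 0) (h7 : x7 ≠ 0) (hta : ta ≠ 0) (hta2 : ta2 ≠ 0) (htX : tX ≠ 0) (htaX : taX ≠ 0)
    (h : x12 * x8 * (tV * x7) - x13 * x9 * (te * x6) = a / e * (x14 * x16 * (taX * tX))) :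
    t2 / ta * ((ta * ta1 * A / taX) * (tb * Bn) * (tc * Cn) * (td * Dn) * (En * x12) * (tV * Fn) /
        ((Q * tX) * (x1 * Bd) * (x2 * Cd) * (x3 * Dd) * (x6 * (x4 * Ed) / x8) * (x5 * Vd))) *
        (K * q) =
      t2 / ta * ((ta * ta1 * A / taX) * (tb * Bn) * (tc * Cn) * (td * Dn) * (te * En) *
        (Fn * x13) / ((Q * tX) * (x1 * Bd) * (x2 * Cd) * (x3 * Dd) * (x4 * Ed) *
          (x7 * (x5 * Vd) / x9))) * (K * q) +
      q * (a / e) * ta1 * ta2 * tb * tc * td * x14 * x16 / (x1 * x2 * x3 * x4 * x6 * x7 * x5) *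
        (t2 / ta2 * (A * Bn * Cn * Dn * En * Fn / (Q * Bd * Cd * Dd * Ed * Vd)) * K) := by
  have h' : x12 * x8 * tV / x6 =
      x13 * x9 * te / x7 + a / e * (x14 * x16 * (taX * tX)) / (x6 * x7) := by
    rw [← h]; field_simp; ring
  have c1 := mul_inv_cancel₀ hta
  have c2 := mul_inv_cancel₀ hta2
  have c3 := mul_inv_cancel₀ htX
  have c4 := mul_inv_cancel₀ htaX
  set G := t2 * ta1 * (A * Bn * Cn * Dn * En * Fn) * tb * tc * td * K * q /
    (Q * Bd * Cd * Dd * Ed * Vd * (x1 * x2 * x3 * x4 * x5) * taX * tX) with hG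
  calc
    _ = (ta * ta⁻¹) * G * (x12 * x8 * tV / x6) := by
      rw [hG]; simp only [div_eq_mul_inv, mul_inv, inv_inv]; ring
    _ = (ta * ta⁻¹) * G * (x13 * x9 * te / x7) +
        (ta2 * ta2⁻¹) * G * (a / e * (x14 * x16 * (taX * tX)) / (x6 * x7)) := by
      rw [h', c1, c2]; ring
    _ = (ta * ta⁻¹) * G * (x13 * x9 * te / x7) +
        (ta2 * ta2⁻¹) * (tX * tX⁻¹) * (taX * taX⁻¹) *
          (q * (a / e) * ta1 * tb * tc * td * x14 * x16 / (x1 * x2 * x3 * x4 * x6 * x7 * x5) *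
            (t2 * (A * Bn * Cn * Dn * En * Fn / (Q * Bd * Cd * Dd * Ed * Vd)) * K)) := by
      rw [hG]; ring
    _ = _ := by
      rw [c3, c4, hG]; simp only [div_eq_mul_inv, mul_inv, inv_inv]; ring

/-- Raising `e` and lowering the terminating parameter `V q`: the addition formula splits the
term into one with the same `a` and one with `a` replaced by `a q²`. -/
lemma vwpTerm_succ {a b c d e V q p : ℂ} (ha : a ≠ 0) (hb : b ≠ 0) (hc : c ≠ 0) (hd : d ≠ 0)
    (he : e ≠ 0) (hV : V ≠ 0) (hq : q ≠ 0) (hp0 : p ≠ 0) (hp : ‖p‖ < 1) (k : ℕ)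
    (ta : ∀ m : ℕ, theta (a * q ^ m) p ≠ 0)
    (tq : ellPoch q q p (k + 1) ≠ 0)
    (te : ellPoch (a / e) q p (k + 2) ≠ 0) (tV : ellPoch (a / V) q p (k + 2) ≠ 0) :
    vwpTerm a b c d (e * q) V q p (k + 1) = vwpTerm a b c d e (V * q) q p (k + 1) +
      vwpCoeff a b c d e V q p *
        vwpTerm (a * q ^ 2) (b * q) (c * q) (d * q) (e * q) (V * q) q p k := by
  have hadd := theta_addition_wellPoised (X := q ^ (k + 1)) (Y := e) (U := 1) (V := V) (p := p)
    ha (by positivity) he one_ne_zero hV hp0 hp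
  have ta0 := ta 0
  have ta1 := ta 1
  have ta2 := ta 2
  have tak := ta (k + 1)
  simp only [pow_zero, mul_one, pow_one, one_mul, div_one] at hadd ta0 ta1
  -- all factorials are expressed by those of `vwpTerm (a q²) …` with index `k`
  have ea : ellPoch a q p (k + 1) =
      theta a p * theta (a * q) p * ellPoch (a * q ^ 2) q p k / theta (a * q ^ (k + 1)) p := by
    rw [eq_div_iff tak, ← ellPoch_succ, ellPoch_succ', ellPoch_succ', mul_assoc a q q, ← sq,
      mul_assoc]
  have eq' : ellPoch q q p (k + 1) = ellPoch q q p k * theta (q ^ (k + 1)) p := by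
    rw [ellPoch_succ, ← pow_succ']
  have eb : ∀ x, ellPoch x q p (k + 1) = theta x p * ellPoch (x * q) q p k :=
    fun x => ellPoch_succ' x q p k
  have ec : ∀ x, x ≠ 0 → a * q ^ 2 * q / (x * q) = a * q / x * q := fun x hx => by field_simp
  have ee : ellPoch (e * q) q p (k + 1) = ellPoch (e * q) q p k * theta (q ^ (k + 1) * e) p := by
    rw [ellPoch_succ]; congr 2; ring
  have exp : ∀ x, x ≠ 0 → ellPoch (a / x) q p (k + 2) =
      theta (a / x) p * (theta (a * q / x) p * ellPoch (a * q / x * q) q p k) := fun x hx => by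
    rw [ellPoch_succ', ellPoch_succ', show a / x * q = a * q / x by ring]
  have exp' : ∀ x, x ≠ 0 → ellPoch (a / x) q p (k + 2) =
      ellPoch (a / x) q p (k + 1) * theta (a * q ^ (k + 1) / x) p := fun x hx => by
    rw [ellPoch_succ]; congr 2; ring
  have te1 : theta (a * q ^ (k + 1) / e) p ≠ 0 := by
    rw [exp' e he] at te; exact right_ne_zero_of_mul te
  have tV1 : theta (a * q ^ (k + 1) / V) p ≠ 0 := by
    rw [exp' V hV] at tV; exact right_ne_zero_of_mul tV
  have ef : ellPoch (a / e) q p (k + 1) = theta (a / e) p * (theta (a * q / e) p *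
      ellPoch (a * q / e * q) q p k) / theta (a * q ^ (k + 1) / e) p := by
    rw [eq_div_iff te1, ← exp' e he, exp e he]
  have eV : ellPoch (a / V) q p (k + 1) = theta (a / V) p * (theta (a * q / V) p *
      ellPoch (a * q / V * q) q p k) / theta (a * q ^ (k + 1) / V) p := by
    rw [eq_div_iff tV1, ← exp' V hV, exp V hV]
  have ev : ellPoch (V * q) q p (k + 1) = ellPoch (V * q) q p k * theta (q ^ (k + 1) * V) p := by
    rw [ellPoch_succ]; congr 2; ring
  rw [exp e he] at te
  rw [exp V hV] at tV
  rw [eq'] at tq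
  simp only [vwpTerm, vwpCoeff]
  rw [show a * q / (e * q) = a / e by field_simp, show a * q / (V * q) = a / V by field_simp,
    ec b hb, ec c hc, ec d hd, ec e he, ec V hV, ea, eq', ee, ef, eV, ev, eb b, eb c, eb d, eb e,
    eb V, eb (a * q / b), eb (a * q / c), eb (a * q / d), eb (a * q / e), eb (a * q / V),
    show a * q ^ 2 * q ^ (2 * k) = a * q ^ (2 * (k + 1)) by ring, pow_succ q k]
  rw [pow_succ q k] at hadd tak tq
  simp only [mul_ne_zero_iff] at te tV tq
  exact vwp_split_algebra te.1 tV.1 ta0 ta2 tq.2 tak (by linear_combination hadd)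

/-- The closed form of the Frenkel–Turaev sum satisfies the recurrence of `vwpTerm_succ`. -/
lemma frenkelTuraev_closed_form_succ {a b c d e V q p : ℂ} {n : ℕ} (ha : a ≠ 0) (hb : b ≠ 0)
    (hc : c ≠ 0) (hd : d ≠ 0) (he : e ≠ 0) (hq : q ≠ 0) (hp0 : p ≠ 0)
    (hp : ‖p‖ < 1) (hVq : V * q ^ (n + 1) = 1) (hbal : b * c * d * e = a ^ 2 * q ^ (n + 1))
    (ta : ∀ m : ℕ, theta (a * q ^ m) p ≠ 0)
    (tb : ellPoch (a * q / b) q p (n + 1) ≠ 0) (tc : ellPoch (a * q / c) q p (n + 1) ≠ 0)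
    (td : ellPoch (a * q / d) q p (n + 1) ≠ 0)
    (te1 : theta (a * q / e) p ≠ 0) (te0 : theta (a / e) p ≠ 0)
    (tg : theta (a / (b * c * d)) p ≠ 0) :
    ellPoch (a * q) q p (n + 1) * ellPoch (a * q / (b * c)) q p (n + 1) *
        ellPoch (a * q / (b * d)) q p (n + 1) * ellPoch (a * q / (c * d)) q p (n + 1) /
        (ellPoch (a * q / b) q p (n + 1) * ellPoch (a * q / c) q p (n + 1) *
          ellPoch (a * q / d) q p (n + 1) * ellPoch (a * q / (b * c * d)) q p (n + 1)) =
      ellPoch (a * q) q p n * ellPoch (a * q / (b * c)) q p n *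
        ellPoch (a * q / (b * d)) q p n * ellPoch (a * q / (c * d)) q p n /
        (ellPoch (a * q / b) q p n * ellPoch (a * q / c) q p n *
          ellPoch (a * q / d) q p n * ellPoch (a * q / (b * c * d)) q p n) +
      vwpCoeff a b c d e V q p *
        (ellPoch (a * q * q * q) q p n * ellPoch (a * q / (b * c)) q p n *
          ellPoch (a * q / (b * d)) q p n * ellPoch (a * q / (c * d)) q p n /
          (ellPoch (a * q / b * q) q p n * ellPoch (a * q / c * q) q p n *
            ellPoch (a * q / d * q) q p n * ellPoch (a / (b * c * d)) q p n)) := by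
  obtain ⟨M, hM⟩ : ∃ M, M = a * q ^ (n + 1) := ⟨_, rfl⟩
  have hM0 : M ≠ 0 := by rw [hM]; positivity
  have hV : V = a / M := by
    rw [hM, eq_div_iff (by positivity)]; linear_combination a * hVq
  have hV0 : V ≠ 0 := by rw [hV]; positivity
  have hea : e / a = M / (b * c * d) := by
    rw [div_eq_div_iff ha (by positivity), hM]; linear_combination hbal
  have hadd := theta_addition_wellPoised (a := M ^ 2 / (b * c)) (X := 1) (Y := M) (U := 1 / d)
    (V := M / b) (p := p) (by positivity) one_ne_zero hM0 (one_div_ne_zero hd) (by positivity)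
    hp0 hp
  rw [show 1 * M = M by ring, show M ^ 2 / (b * c) * 1 / M = M / (b * c) by field_simp,
    show 1 / d * (M / b) = M / (b * d) by field_simp,
    show M ^ 2 / (b * c) * (1 / d) / (M / b) = M / (c * d) by field_simp,
    show 1 * (M / b) = M / b by ring, show M ^ 2 / (b * c) * 1 / (M / b) = M / c by field_simp,
    show 1 / d * M = M / d by field_simp,
    show M ^ 2 / (b * c) * (1 / d) / M = M / (b * c * d) by field_simp,
    show M * (M / b) / (M ^ 2 / (b * c)) = c by field_simp, show M / (M / b) = b by field_simp,
    show M ^ 2 / (b * c) * 1 * (1 / d) = M ^ 2 / (b * c * d) by field_simp,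
    show 1 / (1 / d) = d by field_simp, ← hea] at hadd
  have s1 : ∀ x, ellPoch (a * q / x) q p (n + 1) = ellPoch (a * q / x) q p n * theta (M / x) p :=
    fun x => by rw [ellPoch_succ, hM]; congr 2; ring
  have s1' : ∀ x, ellPoch (a * q / x) q p (n + 1) =
      theta (a * q / x) p * ellPoch (a * q / x * q) q p n := fun x => ellPoch_succ' _ _ _ _
  have s2 : ellPoch (a * q) q p (n + 1) = ellPoch (a * q) q p n * theta M p := by
    rw [ellPoch_succ, hM]; congr 2; ring
  have s3 : ellPoch (a * q * q * q) q p n =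
      ellPoch (a * q) q p n * theta M p * theta (M * q) p /
        (theta (a * q) p * theta (a * q ^ 2) p) := by
    have t1 := ta 1
    have t2 := ta 2
    rw [pow_one] at t1
    rw [eq_div_iff (by positivity), ← s2, hM,
      show a * q ^ (n + 1) * q = a * q * q ^ (n + 1) by ring, ← ellPoch_succ, ellPoch_succ',
      ellPoch_succ', show a * q ^ 2 = a * q * q by ring]
    ring
  have r1 : theta (e / a) p = -(e / a) * theta (a / e) p := by
    rw [← inv_div, theta_inv (by positivity) hp]; field_simp
  have r2 : theta (e / (a * q)) p = -(e / (a * q)) * theta (a * q / e) p := by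
    rw [← inv_div, theta_inv (by positivity) hp]; field_simp
  have hme : theta (e / a) p ≠ 0 := by
    rw [r1]; exact mul_ne_zero (neg_ne_zero.mpr (by positivity)) te0
  have hmq : theta (e / (a * q)) p ≠ 0 := by
    rw [r2]; exact mul_ne_zero (neg_ne_zero.mpr (by positivity)) te1
  have s4 : ellPoch (a / (b * c * d)) q p n = ellPoch (a * q / (b * c * d)) q p n *
      theta (a / (b * c * d)) p / theta (e / (a * q)) p := by
    rw [eq_div_iff hmq, mul_comm (ellPoch (a * q / _) _ _ _),
      show a * q / (b * c * d) = a / (b * c * d) * q by ring, ← ellPoch_succ', ellPoch_succ]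
    congr 2
    rw [← div_div, hea, hM, pow_succ]
    field_simp
  have d1 : ∀ x, ellPoch (a * q / x) q p (n + 1) ≠ 0 → ellPoch (a * q / x * q) q p n =
      ellPoch (a * q / x) q p n * theta (M / x) p / theta (a * q / x) p := fun x hx => by
    rw [← s1, s1' x, mul_div_cancel_left₀]
    rw [s1'] at hx
    exact left_ne_zero_of_mul hx
  have hMq : theta M p ≠ 0 := by rw [hM]; exact ta _
  have hMq' : theta (M * q) p ≠ 0 := by
    rw [hM, mul_assoc, ← pow_succ]; exact ta _
  have t1 : theta (a * q) p ≠ 0 := by simpa using ta 1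
  have t2 := ta 2
  have key : theta M p * theta (M / (b * c)) p * theta (M / (b * d)) p * theta (M / (c * d)) p /
      (theta (M / b) p * theta (M / c) p * theta (M / d) p * theta (e / a) p) = 1 +
      q * (a / e) * theta b p * theta c p * theta d p * theta (M ^ 2 / (b * c * d)) p *
        theta (e / (a * q)) p / (theta (a * q / e) p * theta (a / e) p *
          (theta (M / b) p * theta (M / c) p * theta (M / d) p)) := by
    have hb' : theta (M / b) p ≠ 0 := by rw [s1] at tb; exact right_ne_zero_of_mul tb
    have hc' : theta (M / c) p ≠ 0 := by rw [s1] at tc; exact right_ne_zero_of_mul tc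
    have hd' : theta (M / d) p ≠ 0 := by rw [s1] at td; exact right_ne_zero_of_mul td
    rw [div_eq_iff (by positivity), r2]
    have : theta M p * theta (M / (b * c)) p * theta (M / (b * d)) p * theta (M / (c * d)) p =
      theta (M / b) p * theta (M / c) p * theta (M / d) p * theta (e / a) p +
        e / a * (theta c p * theta b p * (theta (M ^ 2 / (b * c * d)) p * theta d p)) := by
      linear_combination hadd
    rw [this, r1]
    field_simp
    ring
  have hx1 : theta (a * q / b) p ≠ 0 := by rw [s1'] at tb; exact left_ne_zero_of_mul tb
  have hx2 : theta (a * q / c) p ≠ 0 := by rw [s1'] at tc; exact left_ne_zero_of_mul tc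
  have hx3 : theta (a * q / d) p ≠ 0 := by rw [s1'] at td; exact left_ne_zero_of_mul td
  have c1 := mul_inv_cancel₀ t1
  have c2 := mul_inv_cancel₀ t2
  have c3 := mul_inv_cancel₀ hMq
  have c4 := mul_inv_cancel₀ hMq'
  have c5 := mul_inv_cancel₀ tg
  have c6 := mul_inv_cancel₀ hx1
  have c7 := mul_inv_cancel₀ hx2
  have c8 := mul_inv_cancel₀ hx3
  rw [d1 b tb, d1 c tc, d1 d td, s1 b, s1 c, s1 d, s1 (b * c), s1 (b * d), s1 (c * d),
    s1 (b * c * d), s2, s3, s4, vwpCoeff, ← hea, show a / V = M by rw [hV]; field_simp,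
    show a * q / V = M * q by rw [hV]; field_simp,
    show e * V / a = a / (b * c * d) by
      rw [hV, mul_div_assoc, div_right_comm, div_self ha, mul_one_div,
        show e = M / (b * c * d) * a by rw [← hea]; field_simp]
      field_simp,
    show e / V = M ^ 2 / (b * c * d) by
      rw [hV, show e = M / (b * c * d) * a by rw [← hea]; field_simp]
      field_simp]
  set G := ellPoch (a * q) q p n * ellPoch (a * q / (b * c)) q p n *
        ellPoch (a * q / (b * d)) q p n * ellPoch (a * q / (c * d)) q p n /
        (ellPoch (a * q / b) q p n * ellPoch (a * q / c) q p n *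
          ellPoch (a * q / d) q p n * ellPoch (a * q / (b * c * d)) q p n) with hG
  calc
    _ = G * (theta M p * theta (M / (b * c)) p * theta (M / (b * d)) p * theta (M / (c * d)) p /
      (theta (M / b) p * theta (M / c) p * theta (M / d) p * theta (e / a) p)) := by
      rw [hG]; ring
    _ = G + (theta (a * q) p * (theta (a * q) p)⁻¹) *
        (theta (a * q ^ 2) p * (theta (a * q ^ 2) p)⁻¹) * (theta M p * (theta M p)⁻¹) *
        (theta (M * q) p * (theta (M * q) p)⁻¹) *
        (theta (a / (b * c * d)) p * (theta (a / (b * c * d)) p)⁻¹) *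
        (theta (a * q / b) p * (theta (a * q / b) p)⁻¹) *
        (theta (a * q / c) p * (theta (a * q / c) p)⁻¹) *
        (theta (a * q / d) p * (theta (a * q / d) p)⁻¹) *
        (q * (a / e) * theta b p * theta c p * theta d p * theta (M ^ 2 / (b * c * d)) p *
          theta (e / (a * q)) p / (theta (a * q / e) p * theta (a / e) p *
          (theta (M / b) p * theta (M / c) p * theta (M / d) p)) * G) := by
      rw [key, c1, c2, c3, c4, c5, c6, c7, c8]; ring
    _ = _ := by
      rw [hG]; simp only [div_eq_mul_inv, mul_inv, inv_inv]; ring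

/-- The Frenkel–Turaev summation, by induction on `n` through `vwpTerm_succ`. The parameter `e`
is the one that changes with `n`. -/
theorem frenkelTuraev {q p : ℂ} (hq : q ≠ 0) (hp0 : p ≠ 0) (hp : ‖p‖ < 1) (n : ℕ) :
    ∀ {a b c d e f : ℂ}, a ≠ 0 → b ≠ 0 → c ≠ 0 → d ≠ 0 → e ≠ 0 → f * q ^ n = 1 →
      b * c * d * e = a ^ 2 * q ^ (n + 1) → (∀ m : ℕ, theta (a * q ^ m) p ≠ 0) →
      ellPoch q q p n ≠ 0 → ellPoch (a * q / b) q p n ≠ 0 → ellPoch (a * q / c) q p n ≠ 0 →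
      ellPoch (a * q / d) q p n ≠ 0 → (∀ m : ℤ, theta (e * q ^ m) p ≠ 0) →
      (∀ m : ℤ, theta (a * q ^ m / e) p ≠ 0) →
      ∑ k ∈ Finset.range (n + 1), vwpTerm a b c d e f q p k =
        ellPoch (a * q) q p n * ellPoch (a * q / (b * c)) q p n *
          ellPoch (a * q / (b * d)) q p n * ellPoch (a * q / (c * d)) q p n /
          (ellPoch (a * q / b) q p n * ellPoch (a * q / c) q p n *
            ellPoch (a * q / d) q p n * ellPoch (a * q / (b * c * d)) q p n) := by
  induction n with
  | zero =>
    intro a b c d e f _ _ _ _ _ _ _ ta _ _ _ _ _ _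
    have := ta 0
    rw [pow_zero, mul_one] at this
    simp [vwpTerm_zero this, ellPoch_zero]
  | succ n ih =>
    intro a b c d E V ha hb hc hd hE hV hbal ta tq tb tc td tE taE
    obtain ⟨e, rfl⟩ : ∃ e, E = e * q := ⟨E / q, by field_simp⟩
    have he : e ≠ 0 := left_ne_zero_of_mul hE
    have hV0 : V ≠ 0 := by rintro rfl; simp at hV
    have hV' : V * q * q ^ n = 1 := by rw [← hV]; ring
    have hbal' : b * c * d * e = a ^ 2 * q ^ (n + 1) := by
      apply mul_right_cancel₀ hq
      linear_combination hbal
    have te : ∀ m : ℤ, theta (e * q ^ m) p ≠ 0 := fun m => by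
      have := tE (m - 1)
      rwa [mul_assoc, ← zpow_one_add₀ hq, add_sub_cancel] at this
    have tae : ∀ m : ℤ, theta (a * q ^ m / e) p ≠ 0 := fun m => by
      have := taE (m + 1)
      rwa [zpow_add_one₀ hq, ← mul_assoc, mul_div_mul_right _ _ hq] at this
    have haV : a / V = a * q ^ (n + 1) := by
      rw [div_eq_iff hV0]; linear_combination -a * hV
    have hle : ∀ {x : ℂ} {k : ℕ}, k < n + 1 → ellPoch x q p (n + 1) ≠ 0 →
        ellPoch x q p (k + 1) ≠ 0 := fun hk h => ellPoch_ne_zero_of_le h hk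
    have hsh : ∀ x, x ≠ 0 → a * q ^ 2 * q / (x * q) = a * q / x * q := fun x hx => by field_simp
    have hsh' : ∀ x, x ≠ 0 → ellPoch (a * q / x) q p (n + 1) ≠ 0 →
        ellPoch (a * q ^ 2 * q / (x * q)) q p n ≠ 0 := fun x hx h => by
      rw [ellPoch_succ'] at h
      rw [hsh x hx]
      exact right_ne_zero_of_mul h
    have ih1 := ih ha hb hc hd he hV' hbal' ta (ellPoch_ne_zero_of_le tq n.le_succ)
      (ellPoch_ne_zero_of_le tb n.le_succ) (ellPoch_ne_zero_of_le tc n.le_succ)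
      (ellPoch_ne_zero_of_le td n.le_succ) te tae
    have ih2 := ih (a := a * q ^ 2) (b := b * q) (c := c * q) (d := d * q) (e := e * q)
      (by positivity) (by positivity) (by positivity) (by positivity) hE hV'
      (by linear_combination q ^ 4 * hbal')
      (fun m => by rw [mul_assoc, ← pow_add]; exact ta _)
      (ellPoch_ne_zero_of_le tq n.le_succ) (hsh' b hb tb) (hsh' c hc tc) (hsh' d hd td) tE
      (fun m => by
        have := taE (2 + m)
        rwa [zpow_add₀ hq, ← mul_assoc] at this)
    have hlast : vwpTerm a b c d e (V * q) q p (n + 1) = 0 := by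
      simp [vwpTerm, ellPoch_eq_zero hV' n.lt_succ_self]
    have ht0 : theta a p ≠ 0 := by simpa using ta 0
    rw [Finset.sum_range_succ', vwpTerm_zero ht0,
      Finset.sum_congr rfl fun k hk => vwpTerm_succ ha hb hc hd he hV0 hq hp0 hp k ta
        (hle (Finset.mem_range.mp hk) tq)
        (ellPoch_ne_zero fun j _ => by
          have := tae j
          rwa [zpow_natCast, mul_div_right_comm] at this)
        (ellPoch_ne_zero fun j _ => by
          rw [haV, mul_assoc, ← pow_add]; exact ta _),
      Finset.sum_add_distrib, ← Finset.mul_sum, ih2, add_right_comm]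
    have h1 : ∑ k ∈ Finset.range (n + 1), vwpTerm a b c d e (V * q) q p (k + 1) + 1 =
        ∑ k ∈ Finset.range (n + 1), vwpTerm a b c d e (V * q) q p k := by
      rw [← vwpTerm_zero (b := b) (c := c) (d := d) (e := e) (f := V * q) (q := q) ht0,
        ← Finset.sum_range_succ' (vwpTerm a b c d e (V * q) q p), Finset.sum_range_succ, hlast,
        add_zero]
    have te0 : theta (a / e) p ≠ 0 := by simpa using tae 0
    have te1 : theta (a * q / e) p ≠ 0 := by simpa using tae 1
    have tg : theta (a / (b * c * d)) p ≠ 0 := by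
      rw [show a / (b * c * d) = e * q ^ (-(n + 1 : ℤ)) / a * 1 by
        rw [zpow_neg, mul_one, div_eq_div_iff (by positivity) ha]
        rw [show (n + 1 : ℤ) = ((n + 1 : ℕ) : ℤ) by push_cast; rfl, zpow_natCast]
        field_simp
        linear_combination -hbal', mul_one, ← inv_div, theta_inv (by positivity) hp]
      refine div_ne_zero (neg_ne_zero.mpr ?_) (by positivity)
      have := tae (n + 1)
      rwa [show a / (e * q ^ (-(n + 1 : ℤ))) = a * q ^ (n + 1 : ℤ) / e by
        rw [zpow_neg]; field_simp]
    rw [h1, ih1, frenkelTuraev_closed_form_succ ha hb hc hd he hq hp0 hp hV hbal' ta tb tc td te1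
      te0 tg]
    congr 2
    rw [hsh b hb, hsh c hc, hsh d hd, show a * q ^ 2 * q = a * q * q * q by ring,
      show a * q * q * q / (b * q * (c * q)) = a * q / (b * c) by field_simp,
      show a * q * q * q / (b * q * (d * q)) = a * q / (b * d) by field_simp,
      show a * q * q * q / (c * q * (d * q)) = a * q / (c * d) by field_simp,
      show a * q * q * q / (b * q * (c * q) * (d * q)) = a / (b * c * d) by field_simp]

/-! ### Orthogonality -/

/-- The telescoping very-well-poised series: with `b c d = a` the partial sums factor. -/
lemma sum_vwp_telescoping {a b c d q p : ℂ} (hb : b ≠ 0) (hc : c ≠ 0)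
    (hd : d ≠ 0) (hq : q ≠ 0) (hp0 : p ≠ 0) (hp : ‖p‖ < 1) (hbal : b * c * d = a)
    (ta : theta a p ≠ 0) (m : ℕ) (tq : ellPoch q q p m ≠ 0)
    (tb : ellPoch (a * q / b) q p m ≠ 0) (tc : ellPoch (a * q / c) q p m ≠ 0)
    (td : ellPoch (a * q / d) q p m ≠ 0) :
    ∑ k ∈ Finset.range (m + 1), theta (a * q ^ (2 * k)) p / theta a p *
      (ellPoch a q p k * ellPoch b q p k * ellPoch c q p k * ellPoch d q p k /
        (ellPoch q q p k * ellPoch (a * q / b) q p k * ellPoch (a * q / c) q p k *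
          ellPoch (a * q / d) q p k)) * q ^ k =
      ellPoch (a * q) q p m * ellPoch (b * q) q p m * ellPoch (c * q) q p m *
        ellPoch (d * q) q p m /
        (ellPoch q q p m * ellPoch (a * q / b) q p m * ellPoch (a * q / c) q p m *
          ellPoch (a * q / d) q p m) := by
  have ha : a ≠ 0 := by rw [← hbal]; positivity
  induction m with
  | zero => simp [ellPoch_zero, ta]
  | succ m ih =>
    have hle : ∀ {x : ℂ}, ellPoch x q p (m + 1) ≠ 0 → ellPoch x q p m ≠ 0 :=
      fun h => ellPoch_ne_zero_of_le h m.le_succ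
    have s1 : ∀ x, ellPoch (a * q / x) q p (m + 1) =
        ellPoch (a * q / x) q p m * theta (a * q ^ (m + 1) / x) p := fun x => by
      rw [ellPoch_succ]; congr 2; ring
    have s2 : ∀ x, ellPoch (x * q) q p (m + 1) =
        ellPoch (x * q) q p m * theta (x * q ^ (m + 1)) p := fun x => by
      rw [ellPoch_succ]; congr 2; ring
    have s3 : ellPoch q q p (m + 1) = ellPoch q q p m * theta (q ^ (m + 1)) p := by
      rw [ellPoch_succ, ← pow_succ']
    rw [Finset.sum_range_succ, ih (hle tq) (hle tb) (hle tc) (hle td)]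
    rw [s1] at tb tc td
    rw [s3] at tq
    rw [ellPoch_succ' a, ellPoch_succ' b, ellPoch_succ' c, ellPoch_succ' d, s1, s1, s1, s2, s2,
      s2, s2, s3, show a * q ^ (2 * (m + 1)) = a * (q ^ (m + 1)) ^ 2 by ring]
    obtain ⟨Z, hZ⟩ : ∃ Z, Z = q ^ (m + 1) := ⟨_, rfl⟩
    have hZ0 : Z ≠ 0 := by rw [hZ]; positivity
    rw [← hZ] at tq tb tc td ⊢
    have hadd := theta_addition_wellPoised (a := a * b * Z ^ 2) (X := 1) (Y := a * Z) (U := 1 / b)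
      (V := b * c * Z) (p := p) (by positivity) one_ne_zero (by positivity) (one_div_ne_zero hb)
      (by positivity) hp0 hp
    rw [one_mul, one_mul, show a * b * Z ^ 2 * 1 / (a * Z) = b * Z by field_simp,
      show 1 / b * (b * c * Z) = c * Z by field_simp,
      show a * b * Z ^ 2 * (1 / b) / (b * c * Z) = d * Z by rw [← hbal]; field_simp,
      show b * c * Z = a * Z / d by rw [← hbal]; field_simp,
      show a * b * Z ^ 2 * 1 / (a * Z / d) = a * Z / c by rw [← hbal]; field_simp,
      show 1 / b * (a * Z) = a * Z / b by field_simp,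
      show a * b * Z ^ 2 * (1 / b) / (a * Z) = Z by field_simp,
      show a * Z * (a * Z / d) / (a * b * Z ^ 2) = c by rw [← hbal]; field_simp,
      show a * Z / (a * Z / d) = d by field_simp,
      show a * b * Z ^ 2 * 1 * (1 / b) = a * Z ^ 2 by field_simp,
      show 1 / (1 / b) = b by field_simp] at hadd
    have key : theta (a * Z) p * theta (b * Z) p * theta (c * Z) p * theta (d * Z) p /
        (theta Z p * theta (a * Z / b) p * theta (a * Z / c) p * theta (a * Z / d) p) = 1 +
        theta (a * Z ^ 2) p * (theta b p * theta c p * theta d p) * Z /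
        (theta Z p * theta (a * Z / b) p * theta (a * Z / c) p * theta (a * Z / d) p) := by
      have h1 := right_ne_zero_of_mul tq
      have h2 := right_ne_zero_of_mul tb
      have h3 := right_ne_zero_of_mul tc
      have h4 := right_ne_zero_of_mul td
      rw [div_eq_iff (by positivity), add_mul, div_mul_cancel₀ _ (by positivity)]
      linear_combination hadd
    have c1 := mul_inv_cancel₀ ta
    set G := ellPoch (a * q) q p m * ellPoch (b * q) q p m * ellPoch (c * q) q p m *
        ellPoch (d * q) q p m /
        (ellPoch q q p m * ellPoch (a * q / b) q p m * ellPoch (a * q / c) q p m *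
          ellPoch (a * q / d) q p m) with hG
    calc
      _ = G + (theta a p * (theta a p)⁻¹) * (G * (theta (a * Z ^ 2) p *
          (theta b p * theta c p * theta d p) * Z / (theta Z p * theta (a * Z / b) p *
          theta (a * Z / c) p * theta (a * Z / d) p))) := by rw [hG]; ring
      _ = G * (theta (a * Z) p * theta (b * Z) p * theta (c * Z) p * theta (d * Z) p /
        (theta Z p * theta (a * Z / b) p * theta (a * Z / c) p * theta (a * Z / d) p)) := by
        rw [key, c1]; ring
      _ = _ := by rw [hG]; ring

/-- The product of the `(n, k)` entry of one and the `(k, j)` entry of the other of two lower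
triangular matrices that are inverse to each other up to a diagonal factor; see
`sum_inversionTerm`. -/
noncomputable def inversionTerm (x y q p : ℂ) (n k j : ℕ) : ℂ :=
  theta (x * q ^ (2 * k)) p / theta x p *
    (ellPoch x q p k * ellPoch (x / y) q p k * ellPoch (y * q ^ n) q p k *
      ellPoch (q ^ n)⁻¹ q p k /
      (ellPoch q q p k * ellPoch (y * q) q p k * ellPoch (x * q / (y * q ^ n)) q p k *
        ellPoch (x * q ^ (n + 1)) q p k)) * q ^ k *
    (ellPoch (x * q ^ k) q p j * ellPoch (q ^ k)⁻¹ q p j /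
      (ellPoch (y * q / (x * q ^ k)) q p j * ellPoch (y * q ^ (k + 1)) q p j))

lemma ellPoch_inv_pow_eq_zero {q p : ℂ} (hq : q ≠ 0) {k j : ℕ} (h : k < j) :
    ellPoch (q ^ k)⁻¹ q p j = 0 :=
  ellPoch_eq_zero (inv_mul_cancel₀ (pow_ne_zero k hq)) h

lemma inversionTerm_eq_zero {x y q p : ℂ} (hq : q ≠ 0) {n k j : ℕ} (h : k < j) :
    inversionTerm x y q p n k j = 0 := by
  simp [inversionTerm, ellPoch_inv_pow_eq_zero hq h]

/-- Shifting the summation index turns the product of the two matrices into a very-well-poised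
series. -/
lemma inversionTerm_add {x y q p : ℂ} (hx : x ≠ 0) (hy : y ≠ 0) (hq : q ≠ 0) (hp : ‖p‖ < 1)
    (tx : ∀ m : ℕ, theta (x * q ^ m) p ≠ 0)
    (txy : ∀ m : ℕ, theta (x / y * q ^ m) p ≠ 0) {n j i : ℕ} (tq : ellPoch q q p (i + j) ≠ 0) :
    inversionTerm x y q p n (j + i) j = inversionTerm x y q p n j j *
      (theta (x * q ^ (2 * j) * q ^ (2 * i)) p / theta (x * q ^ (2 * j)) p *
        (ellPoch (x * q ^ (2 * j)) q p i * ellPoch (x / y) q p i *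
          ellPoch (y * q ^ (n + j)) q p i * ellPoch (q ^ j / q ^ n) q p i /
          (ellPoch q q p i * ellPoch (y * q ^ (2 * j + 1)) q p i *
            ellPoch (x * q ^ (j + 1) / (y * q ^ n)) q p i *
            ellPoch (x * q ^ (n + j + 1)) q p i)) * q ^ i) := by
  have e1 : ∀ i, ellPoch x q p (j + i) * ellPoch (x * q ^ (j + i)) q p j =
      ellPoch x q p (2 * j) * ellPoch (x * q ^ (2 * j)) q p i := fun i => by
    rw [← ellPoch_add, ← ellPoch_add]; congr 1; omega
  have e2 : ∀ i, ellPoch (y * q) q p (j + i) * ellPoch (y * q ^ (j + i + 1)) q p j =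
      ellPoch (y * q) q p (2 * j) * ellPoch (y * q ^ (2 * j + 1)) q p i := fun i => by
    rw [show y * q ^ (j + i + 1) = y * q * q ^ (j + i) by ring,
      show y * q ^ (2 * j + 1) = y * q * q ^ (2 * j) by ring, ← ellPoch_add, ← ellPoch_add]
    congr 1; omega
  have e3 : ∀ i, ellPoch (y * q / (x * q ^ (j + i))) q p j =
      (-(y * q / (x * q ^ (j + i)))) ^ j * q ^ j.choose 2 * ellPoch (x / y * q ^ i) q p j :=
    fun i => ellPoch_reflect (by positivity) hq hp (by field_simp; ring)
  have e4 : ∀ i, ellPoch (q ^ (j + i))⁻¹ q p j =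
      (-(q ^ (j + i))⁻¹) ^ j * q ^ j.choose 2 * ellPoch (q * q ^ i) q p j :=
    fun i => ellPoch_reflect (by positivity) hq hp (by field_simp; ring)
  have e5 : ∀ i, ellPoch (x / y) q p (j + i) =
      ellPoch (x / y) q p i * ellPoch (x / y * q ^ i) q p j := fun i => by
    rw [← ellPoch_add, add_comm]
  have e6 : ∀ i, ellPoch q q p (j + i) = ellPoch q q p i * ellPoch (q * q ^ i) q p j := fun i => by
    rw [← ellPoch_add, add_comm]
  have h3 : ∀ i, ellPoch (x / y * q ^ i) q p j ≠ 0 := fun i =>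
    ellPoch_ne_zero fun m _ => by rw [mul_assoc, ← pow_add]; exact txy _
  have h4 : ellPoch (q * q ^ i) q p j ≠ 0 := by
    rw [ellPoch_add] at tq; exact right_ne_zero_of_mul tq
  have h4' : ellPoch (q * q ^ 0) q p j ≠ 0 := by
    rw [pow_zero, mul_one]; exact ellPoch_ne_zero_of_le tq (by omega)
  -- the two matrices contribute reciprocal elementary factors
  have r : ∀ i, ellPoch (q * q ^ i) q p j ≠ 0 →
      ellPoch (x / y) q p (j + i) * ellPoch (q ^ (j + i))⁻¹ q p j /
      (ellPoch q q p (j + i) * ellPoch (y * q / (x * q ^ (j + i))) q p j) =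
      (x / (y * q)) ^ j * (ellPoch (x / y) q p i / ellPoch q q p i) := fun i hi => by
    have h := h3 i
    have h0 : (-(q ^ (j + i))⁻¹) ^ j / (-(y * q / (x * q ^ (j + i)))) ^ j = (x / (y * q)) ^ j := by
      rw [← div_pow]; congr 1; field_simp
    rw [e3, e4, e5, e6, ← h0]
    have c1 := mul_inv_cancel₀ h
    have c2 := mul_inv_cancel₀ hi
    have c3 := mul_inv_cancel₀ (pow_ne_zero (j.choose 2) hq)
    calc
      _ = (ellPoch (x / y * q ^ i) q p j * (ellPoch (x / y * q ^ i) q p j)⁻¹) *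
        (ellPoch (q * q ^ i) q p j * (ellPoch (q * q ^ i) q p j)⁻¹) *
        (q ^ j.choose 2 * (q ^ j.choose 2)⁻¹) *
        ((-(q ^ (j + i))⁻¹) ^ j / (-(y * q / (x * q ^ (j + i)))) ^ j *
          (ellPoch (x / y) q p i / ellPoch q q p i)) := by
          simp only [div_eq_mul_inv, mul_inv]; ring
      _ = _ := by rw [c1, c2, c3]; ring
  have split : ∀ i, inversionTerm x y q p n (j + i) j =
      theta (x * q ^ (2 * (j + i))) p / theta x p *
      (ellPoch x q p (j + i) * ellPoch (x * q ^ (j + i)) q p j) /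
      (ellPoch (y * q) q p (j + i) * ellPoch (y * q ^ (j + i + 1)) q p j) *
      (ellPoch (x / y) q p (j + i) * ellPoch (q ^ (j + i))⁻¹ q p j /
      (ellPoch q q p (j + i) * ellPoch (y * q / (x * q ^ (j + i))) q p j)) *
      (ellPoch (y * q ^ n) q p (j + i) * ellPoch (q ^ n)⁻¹ q p (j + i) /
        (ellPoch (x * q / (y * q ^ n)) q p (j + i) * ellPoch (x * q ^ (n + 1)) q p (j + i))) *
      q ^ (j + i) := fun i => by
    rw [inversionTerm]; ring
  have s0 := split 0
  rw [e1, e2, r 0 h4', add_zero, ellPoch_zero, ellPoch_zero, ellPoch_zero, ellPoch_zero,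
    div_one, mul_one, mul_one, mul_one] at s0
  have c := mul_inv_cancel₀ (tx (2 * j))
  rw [split, e1, e2, r i h4, s0, ellPoch_add (y * q ^ n), ellPoch_add (q ^ n)⁻¹,
    ellPoch_add (x * q / (y * q ^ n)), ellPoch_add (x * q ^ (n + 1)),
    show (q ^ n)⁻¹ * q ^ j = q ^ j / q ^ n by ring,
    show y * q ^ n * q ^ j = y * q ^ (n + j) by ring,
    show x * q / (y * q ^ n) * q ^ j = x * q ^ (j + 1) / (y * q ^ n) by ring,
    show x * q ^ (n + 1) * q ^ j = x * q ^ (n + j + 1) by ring,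
    show x * q ^ (2 * j) * q ^ (2 * i) = x * q ^ (2 * (j + i)) by ring]
  refine (one_mul _).symm.trans ?_
  rw [← c]
  ring

/-- Orthogonality: for `j < n` the telescoping series terminates inside its range, and its closed
form contains the factor `θ(1) = 0`. -/
lemma sum_inversionTerm {x y q p : ℂ} (hx : x ≠ 0) (hy : y ≠ 0) (hq : q ≠ 0) (hp0 : p ≠ 0)
    (hp : ‖p‖ < 1) (tx : ∀ m : ℕ, theta (x * q ^ m) p ≠ 0)
    (ty : ∀ m : ℕ, theta (y * q ^ m) p ≠ 0)
    (txy : ∀ m : ℤ, theta (x / y * q ^ m) p ≠ 0) {n j : ℕ} (tq : ellPoch q q p n ≠ 0)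
    (hj : j < n) :
    ∑ k ∈ Finset.range (n + 1), inversionTerm x y q p n k j = 0 := by
  obtain ⟨m, rfl⟩ : ∃ m, n = j + m := ⟨n - j, by omega⟩
  have hm : 0 < m := by omega
  have hxy : ∀ i : ℕ, theta (x / y * q ^ i) p ≠ 0 := fun i => by simpa using txy i
  rw [add_assoc, Finset.sum_range_add, Finset.sum_eq_zero fun k hk =>
    inversionTerm_eq_zero hq (Finset.mem_range.mp hk), zero_add,
    Finset.sum_congr rfl fun i hi => inversionTerm_add hx hy hq hp tx hxy
      (ellPoch_ne_zero_of_le tq (by have := Finset.mem_range.mp hi; omega)), ← Finset.mul_sum]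
  have h := sum_vwp_telescoping (a := x * q ^ (2 * j)) (b := x / y) (c := y * q ^ (j + m + j))
    (d := q ^ j / q ^ (j + m)) (q := q) (p := p) (by positivity) (by positivity) (by positivity)
    hq hp0 hp (by field_simp; ring) (tx _) m
    (ellPoch_ne_zero_of_le tq (by omega))
    (ellPoch_ne_zero fun i _ => by
      rw [show x * q ^ (2 * j) * q / (x / y) * q ^ i = y * q ^ (2 * j + 1 + i) by
        field_simp; ring]
      exact ty _)
    (ellPoch_ne_zero fun i _ => by
      have := txy (1 + i - m)
      rwa [show x * q ^ (2 * j) * q / (y * q ^ (j + m + j)) * q ^ i =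
        x / y * q ^ ((1 : ℤ) + i - m) by
          rw [zpow_sub₀ hq, zpow_add₀ hq, zpow_natCast, zpow_natCast, zpow_one]
          field_simp; ring])
    (ellPoch_ne_zero fun i _ => by
      rw [show x * q ^ (2 * j) * q / (q ^ j / q ^ (j + m)) * q ^ i =
        x * q ^ (2 * j + 1 + m + i) by field_simp; ring]
      exact tx _)
  rw [show x * q ^ (2 * j) * q / (x / y) = y * q ^ (2 * j + 1) by field_simp; ring,
    show x * q ^ (2 * j) * q / (y * q ^ (j + m + j)) = x * q ^ (j + 1) / (y * q ^ (j + m)) by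
      field_simp; ring,
    show x * q ^ (2 * j) * q / (q ^ j / q ^ (j + m)) = x * q ^ (j + m + j + 1) by
      field_simp; ring,
    ellPoch_eq_zero (m := m - 1) (n := m) (x := q ^ j / q ^ (j + m) * q) (by
      obtain ⟨l, rfl⟩ : ∃ l, m = l + 1 := ⟨m - 1, by omega⟩
      rw [Nat.add_sub_cancel]; field_simp; ring) (by omega), mul_zero, zero_div] at h
  rw [h, mul_zero]

/-- The diagonal factor of the pair of matrices. -/
lemma inversionTerm_self {x y q p : ℂ} (hx : x ≠ 0) (hy : y ≠ 0) (hq : q ≠ 0)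
    (hp : ‖p‖ < 1) (tx : ∀ m : ℕ, theta (x * q ^ m) p ≠ 0)
    (ty : ∀ m : ℕ, theta (y * q ^ m) p ≠ 0)
    (txy : ∀ m : ℕ, theta (x / y * q ^ m) p ≠ 0) {n : ℕ} (tq : ellPoch q q p n ≠ 0) :
    inversionTerm x y q p n n n = theta y p / theta (y * q ^ (2 * n)) p *
      (ellPoch (x * q) q p n * ellPoch q q p n / (ellPoch y q p n * ellPoch (y / x) q p n)) *
      (q ^ n)⁻¹ := by
  have e1 : ∀ z, ellPoch z q p n * ellPoch (z * q ^ n) q p n * theta (z * q ^ (2 * n)) p =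
      theta z p * (ellPoch (z * q) q p n * ellPoch (z * q ^ (n + 1)) q p n) := fun z => by
    rw [← ellPoch_add, ← two_mul, ← ellPoch_succ, show z * q ^ (n + 1) = z * q * q ^ n by ring,
      ← ellPoch_add, ← two_mul, ellPoch_succ']
  have hnx : ∀ l m, ellPoch (x * q ^ l) q p m ≠ 0 := fun l m =>
    ellPoch_ne_zero fun i _ => by rw [mul_assoc, ← pow_add]; exact tx _
  have hny : ∀ l m, ellPoch (y * q ^ l) q p m ≠ 0 := fun l m =>
    ellPoch_ne_zero fun i _ => by rw [mul_assoc, ← pow_add]; exact ty _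
  have hxq := hnx (n + 1) n
  have hyq := hny (n + 1) n
  have hyq1 := hny 1 n
  have hy0 := hny 0 n
  rw [pow_one] at hyq1
  rw [pow_zero, mul_one] at hy0
  have tx0 : theta x p ≠ 0 := by simpa using tx 0
  have ex : theta (x * q ^ (2 * n)) p / theta x p *
      (ellPoch x q p n * ellPoch (x * q ^ n) q p n / ellPoch (x * q ^ (n + 1)) q p n) =
      ellPoch (x * q) q p n := by
    field_simp
    linear_combination e1 x
  have ey : ellPoch (y * q ^ n) q p n /
      (ellPoch (y * q) q p n * ellPoch (y * q ^ (n + 1)) q p n) =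
      theta y p / (theta (y * q ^ (2 * n)) p * ellPoch y q p n) := by
    have := ty (2 * n)
    rw [div_eq_div_iff (by positivity) (by positivity)]
    linear_combination e1 y
  have r1 : ellPoch (q ^ n)⁻¹ q p n = (-(q ^ n)⁻¹) ^ n * q ^ n.choose 2 * ellPoch q q p n :=
    ellPoch_reflect hq hq hp (by field_simp)
  have r2 : ellPoch (x * q / (y * q ^ n)) q p n =
      (-(x * q / (y * q ^ n))) ^ n * q ^ n.choose 2 * ellPoch (y / x) q p n :=
    ellPoch_reflect (by positivity) hq hp (by field_simp)
  have r3 : ellPoch (y * q / (x * q ^ n)) q p n =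
      (-(y * q / (x * q ^ n))) ^ n * q ^ n.choose 2 * ellPoch (x / y) q p n :=
    ellPoch_reflect (by positivity) hq hp (by field_simp)
  have pw : (-(q ^ n)⁻¹) ^ n * (-(q ^ n)⁻¹) ^ n * q ^ n /
      ((-(x * q / (y * q ^ n))) ^ n * (-(y * q / (x * q ^ n))) ^ n) = q⁻¹ ^ n := by
    rw [← mul_pow, ← mul_pow, ← mul_pow, ← div_pow]
    congr 1
    field_simp
  have c1 := mul_inv_cancel₀ (ellPoch_ne_zero fun i _ => txy i : ellPoch (x / y) q p n ≠ 0)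
  have c2 := mul_inv_cancel₀ tq
  have c3 := mul_inv_cancel₀ (pow_ne_zero (n.choose 2) hq)
  rw [inversionTerm, r1, r2, r3]
  calc
    _ = (theta (x * q ^ (2 * n)) p / theta x p *
      (ellPoch x q p n * ellPoch (x * q ^ n) q p n / ellPoch (x * q ^ (n + 1)) q p n)) *
      (ellPoch (y * q ^ n) q p n /
        (ellPoch (y * q) q p n * ellPoch (y * q ^ (n + 1)) q p n)) *
      ((-(q ^ n)⁻¹) ^ n * (-(q ^ n)⁻¹) ^ n * q ^ n /
      ((-(x * q / (y * q ^ n))) ^ n * (-(y * q / (x * q ^ n))) ^ n)) *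
      (ellPoch (x / y) q p n * (ellPoch (x / y) q p n)⁻¹) *
      (ellPoch q q p n * (ellPoch q q p n)⁻¹) *
      (q ^ n.choose 2 * (q ^ n.choose 2)⁻¹) ^ 2 *
      (ellPoch q q p n / ellPoch (y / x) q p n) := by
        generalize (-(q ^ n)⁻¹) ^ n = u1
        generalize (-(x * q / (y * q ^ n))) ^ n = u2
        generalize (-(y * q / (x * q ^ n))) ^ n = u3
        ring
    _ = _ := by
        rw [ex, ey, pw, c1, c2, c3, inv_pow]; ring

/-! ### The quadratic summation for generic `a` -/

/-- The `k`-th term of the quadratic sum, after combining the factorials whose parameters differ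
by a factor `p` or `q` into factorials of doubled length. -/
noncomputable def quadTerm (a b q p : ℂ) (n k : ℕ) : ℂ :=
  theta (a * b * (q ^ 2) ^ (2 * k)) (p ^ 2) / theta (a * b) (p ^ 2) *
    (ellPoch (a * b) (q ^ 2) (p ^ 2) k * ellPoch (a * q ^ 2 / b) (q ^ 2) (p ^ 2) k *
        ellPoch (a ^ 2 * (q ^ 2) ^ n) (q ^ 2) (p ^ 2) k *
        ellPoch ((q ^ 2) ^ n)⁻¹ (q ^ 2) (p ^ 2) k /
      (ellPoch (q ^ 2) (q ^ 2) (p ^ 2) k * ellPoch (b ^ 2) (q ^ 2) (p ^ 2) k *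
        ellPoch (a * b * q ^ 2 / (a ^ 2 * (q ^ 2) ^ n)) (q ^ 2) (p ^ 2) k *
        ellPoch (a * b * (q ^ 2) ^ (n + 1)) (q ^ 2) (p ^ 2) k)) *
    (ellPoch b q p (2 * k) / ellPoch (a * q) q p (2 * k)) * (b * q / a) ^ k

/-- The closed form of the quadratic sum. -/
noncomputable def quadValue (a b q p : ℂ) (n : ℕ) : ℂ :=
  theta a p / theta (a * q ^ (2 * n)) p *
    (ellPoch (-q) q p n * ellPoch (a * q / b) q p n / (ellPoch a q p n * ellPoch (-b) q p n)) *
    (ellPoch (a * b * q ^ 2) (q ^ 2) (p ^ 2) n / ellPoch (a / b) (q ^ 2) (p ^ 2) n) * (q ^ n)⁻¹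

/-- The parameter `a` avoids all zeros of the theta functions occurring as denominators in the
inversion argument. -/
structure IsGeneric (a b q p : ℂ) : Prop where
  pos : ∀ m : ℤ, theta (a * q ^ m) p ≠ 0
  neg : ∀ m : ℤ, theta (-a * q ^ m) p ≠ 0
  mul : ∀ m : ℤ, theta (a * b * (q ^ 2) ^ m) (p ^ 2) ≠ 0
  div : ∀ m : ℤ, theta (a / b * (q ^ 2) ^ m) (p ^ 2) ≠ 0

/-- The weights of the Frenkel–Turaev sum that is inverse to the quadratic sum. -/
noncomputable def innerWeight (a b q p : ℂ) (j : ℕ) : ℂ :=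
  theta (-a * q ^ (2 * j)) p / theta (-a) p *
    (ellPoch (-a) q p j * ellPoch (a * q / b) q p j / (ellPoch q q p j * ellPoch (-b) q p j)) *
    q ^ j

lemma zpow_sq_comm (q : ℂ) (m : ℤ) : (q ^ m) ^ 2 = (q ^ 2) ^ m := by
  rw [← zpow_natCast, ← zpow_natCast, ← zpow_mul, ← zpow_mul, mul_comm]

/-- The Frenkel–Turaev sum with parameters `-a; a q / b, ± √(ab) q^k, ± q^{-k}`, in which the pairs
of opposite parameters combine into factorials of base `(q², p²)`. -/
lemma sum_innerWeight {a b q p : ℂ} (ha : a ≠ 0) (hb : b ≠ 0) (hq : q ≠ 0) (hp0 : p ≠ 0)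
    (hp : ‖p‖ < 1) (hg : IsGeneric a b q p) {k : ℕ} (tq : ellPoch (q ^ 2) (q ^ 2) (p ^ 2) k ≠ 0)
    (tb : ellPoch (b ^ 2) (q ^ 2) (p ^ 2) k ≠ 0) :
    ∑ j ∈ Finset.range (k + 1), innerWeight a b q p j *
      (ellPoch (a * b * (q ^ 2) ^ k) (q ^ 2) (p ^ 2) j * ellPoch ((q ^ 2) ^ k)⁻¹ (q ^ 2) (p ^ 2) j /
        (ellPoch (a ^ 2 * q ^ 2 / (a * b * (q ^ 2) ^ k)) (q ^ 2) (p ^ 2) j *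
          ellPoch (a ^ 2 * (q ^ 2) ^ (k + 1)) (q ^ 2) (p ^ 2) j)) =
      ellPoch (a ^ 2 * q ^ 2) (q ^ 2) (p ^ 2) k * ellPoch (a * q ^ 2 / b) (q ^ 2) (p ^ 2) k *
        ellPoch b q p (2 * k) / (ellPoch (b ^ 2) (q ^ 2) (p ^ 2) k *
          ellPoch (b / a) (q ^ 2) (p ^ 2) k * ellPoch (a * q) q p (2 * k)) * (b / (a * q)) ^ k := by
  obtain ⟨s, hs⟩ := IsAlgClosed.exists_pow_nat_eq (a * b) (n := 2) two_pos
  have hs0 : s ≠ 0 := by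
    rintro rfl
    exact mul_ne_zero ha hb (by rw [← hs]; ring)
  have hab : a * b = s ^ 2 := hs.symm
  rw [← ellPoch_mul_neg _ _ hp] at tq tb
  have ts : ∀ m : ℤ, theta (s * q ^ m) p ≠ 0 := fun m => by
    have := hg.mul m
    rw [hab, show s ^ 2 * (q ^ 2) ^ m = (s * q ^ m) ^ 2 by
      rw [mul_pow, zpow_sq_comm],
      ← theta_mul_theta_neg _ hp] at this
    exact left_ne_zero_of_mul this
  have has : ∀ m : ℤ, theta (a / s * q ^ m) p ≠ 0 ∧ theta (-(a / s * q ^ m)) p ≠ 0 := fun m => by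
    have := hg.div m
    rw [show a / b * (q ^ 2) ^ m = (a / s * q ^ m) ^ 2 by
      rw [mul_pow, zpow_sq_comm, div_pow, ← hab, show a ^ 2 / (a * b) = a / b by field_simp],
      ← theta_mul_theta_neg _ hp] at this
    exact ⟨left_ne_zero_of_mul this, right_ne_zero_of_mul this⟩
  have h := frenkelTuraev hq hp0 hp k (a := -a) (b := a * q / b) (c := -(s * q ^ k))
    (d := -(q ^ k)⁻¹) (e := s * q ^ k) (f := (q ^ k)⁻¹) (by simpa using ha) (by positivity)
    (neg_ne_zero.mpr (by positivity)) (neg_ne_zero.mpr (by positivity)) (by positivity)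
    (inv_mul_cancel₀ (by positivity))
    (by
      field_simp
      linear_combination (-(q * q ^ k)) * hab)
    (fun m => by simpa using hg.neg m)
    (left_ne_zero_of_mul tq)
    (by
      rw [show -a * q / (a * q / b) = -b by field_simp]
      exact right_ne_zero_of_mul tb)
    (ellPoch_ne_zero fun j _ => by
      have := (has (1 + j - k)).1
      rwa [show a / s * q ^ ((1 : ℤ) + j - k) = -a * q / -(s * q ^ k) * q ^ j by
        rw [zpow_sub₀ hq, zpow_add₀ hq, zpow_natCast, zpow_natCast, zpow_one]
        field_simp] at this)
    (ellPoch_ne_zero fun j _ => by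
      have := hg.pos (1 + j + k)
      rwa [show a * q ^ ((1 : ℤ) + j + k) = -a * q / -(q ^ k)⁻¹ * q ^ j by
        rw [zpow_add₀ hq, zpow_add₀ hq, zpow_natCast, zpow_natCast, zpow_one]
        field_simp] at this)
    (fun m => by
      have := ts (k + m)
      rwa [zpow_add₀ hq, zpow_natCast, ← mul_assoc] at this)
    (fun m => by
      have := (has (m - k)).2
      rwa [show -(a / s * q ^ (m - k)) = -a * q ^ m / (s * q ^ k) by
        rw [zpow_sub₀ hq, zpow_natCast]
        field_simp] at this)
  have hterm : ∀ j,
      vwpTerm (-a) (a * q / b) (-(s * q ^ k)) (-(q ^ k)⁻¹) (s * q ^ k) (q ^ k)⁻¹ q p j =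
      innerWeight a b q p j *
      (ellPoch (a * b * (q ^ 2) ^ k) (q ^ 2) (p ^ 2) j * ellPoch ((q ^ 2) ^ k)⁻¹ (q ^ 2) (p ^ 2) j /
        (ellPoch (a ^ 2 * q ^ 2 / (a * b * (q ^ 2) ^ k)) (q ^ 2) (p ^ 2) j *
          ellPoch (a ^ 2 * (q ^ 2) ^ (k + 1)) (q ^ 2) (p ^ 2) j)) := fun j => by
    rw [hab, show s ^ 2 * (q ^ 2) ^ k = (s * q ^ k) ^ 2 by ring,
      show ((q ^ 2) ^ k)⁻¹ = ((q ^ k)⁻¹) ^ 2 by rw [inv_pow, ← pow_mul, ← pow_mul, mul_comm],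
      show a ^ 2 * q ^ 2 / (s * q ^ k) ^ 2 = (a * q / (s * q ^ k)) ^ 2 by ring,
      show a ^ 2 * (q ^ 2) ^ (k + 1) = (a * q ^ (k + 1)) ^ 2 by ring,
      ← ellPoch_mul_neg _ _ hp, ← ellPoch_mul_neg _ _ hp, ← ellPoch_mul_neg _ _ hp,
      ← ellPoch_mul_neg _ _ hp, vwpTerm, innerWeight,
      show -a * q / (a * q / b) = -b by field_simp,
      show -a * q / -(s * q ^ k) = a * q / (s * q ^ k) by rw [neg_mul, neg_div_neg_eq],
      show -a * q / (s * q ^ k) = -(a * q / (s * q ^ k)) by rw [neg_mul, neg_div],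
      show -a * q / -(q ^ k)⁻¹ = a * q ^ (k + 1) by field_simp; ring,
      show -a * q / (q ^ k)⁻¹ = -(a * q ^ (k + 1)) by field_simp; ring]
    ring
  rw [Finset.sum_congr rfl fun j _ => (hterm j).symm, h]
  have r1 : ellPoch (b / (s * q ^ k)) q p k =
      (-(b / (s * q ^ k))) ^ k * q ^ k.choose 2 * ellPoch (a * q / s) q p k :=
    ellPoch_reflect (by positivity) hq hp (by field_simp; linear_combination hab)
  have r2 : ellPoch (a * q / (s * q ^ k)) q p k =
      (-(a * q / (s * q ^ k))) ^ k * q ^ k.choose 2 * ellPoch (b / s) q p k :=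
    ellPoch_reflect (by positivity) hq hp (by field_simp; linear_combination hab)
  have pw : (-(b / (s * q ^ k))) ^ k / (-(a * q / (s * q ^ k))) ^ k = (b / (a * q)) ^ k := by
    rw [← div_pow]; congr 1; field_simp
  have m1 : ellPoch (a * q ^ 2 / b) (q ^ 2) (p ^ 2) k =
      ellPoch (a * q / s) q p k * ellPoch (-(a * q / s)) q p k := by
    rw [ellPoch_mul_neg _ _ hp]; congr 1; rw [div_pow, ← hab]; field_simp
  have m2 : ellPoch (b / a) (q ^ 2) (p ^ 2) k =
      ellPoch (b / s) q p k * ellPoch (-(b / s)) q p k := by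
    rw [ellPoch_mul_neg _ _ hp]; congr 1; rw [div_pow, ← hab]; field_simp
  have hd1 := mul_inv_cancel₀ (left_ne_zero_of_mul tb)
  have hd2 : ellPoch (a * q) q p k * (ellPoch (a * q) q p k)⁻¹ = 1 :=
    mul_inv_cancel₀ (ellPoch_ne_zero fun j _ => by
      have := hg.pos (1 + j)
      rwa [zpow_add₀ hq, zpow_one, zpow_natCast, ← mul_assoc] at this)
  have hd3 := mul_inv_cancel₀ (pow_ne_zero (k.choose 2) hq)
  rw [show -a * q / (a * q / b) = -b by field_simp, show -a * q = -(a * q) by ring,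
    show -(a * q) / (a * q / b * -(s * q ^ k)) = b / (s * q ^ k) by field_simp,
    show -(a * q) / (a * q / b * -(q ^ k)⁻¹) = b * q ^ k by field_simp,
    show -(a * q) / (-(s * q ^ k) * -(q ^ k)⁻¹) = -(a * q / s) by field_simp,
    show -(a * q) / -(s * q ^ k) = a * q / (s * q ^ k) by rw [neg_div_neg_eq],
    show -(a * q) / -(q ^ k)⁻¹ = a * q * q ^ k by field_simp,
    show -(a * q) / (a * q / b * -(s * q ^ k) * -(q ^ k)⁻¹) = -(b / s) by field_simp,
    r1, r2, m1, m2, ← pw, two_mul, ellPoch_add, ellPoch_add,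
    show a ^ 2 * q ^ 2 = (a * q) ^ 2 by ring, ← ellPoch_mul_neg _ _ hp, ← ellPoch_mul_neg _ _ hp]
  generalize (-(b / (s * q ^ k))) ^ k = u1
  generalize (-(a * q / (s * q ^ k))) ^ k = u2
  symm
  calc
    _ = (ellPoch b q p k * (ellPoch b q p k)⁻¹) *
      (ellPoch (a * q) q p k * (ellPoch (a * q) q p k)⁻¹) * (ellPoch (-(a * q)) q p k *
      (ellPoch (a * q / s) q p k * ellPoch (-(a * q / s)) q p k) * ellPoch (b * q ^ k) q p k /
      (ellPoch (-b) q p k * (ellPoch (b / s) q p k * ellPoch (-(b / s)) q p k) *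
        ellPoch (a * q * q ^ k) q p k) * (u1 / u2)) := by ring
    _ = (q ^ k.choose 2 * (q ^ k.choose 2)⁻¹) * (ellPoch (-(a * q)) q p k *
      (ellPoch (a * q / s) q p k * ellPoch (-(a * q / s)) q p k) * ellPoch (b * q ^ k) q p k /
      (ellPoch (-b) q p k * (ellPoch (b / s) q p k * ellPoch (-(b / s)) q p k) *
        ellPoch (a * q * q ^ k) q p k) * (u1 / u2)) := by rw [hd1, hd2, hd3]; ring
    _ = _ := by ring

/-- The quadratic summation for generic `a`: insert `sum_innerWeight` into the quadratic sum and
interchange the summations; by orthogonality only the last term survives. -/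
lemma sum_quadTerm_of_isGeneric {a b q p : ℂ} (ha : a ≠ 0) (hb : b ≠ 0) (hq : q ≠ 0) (hp0 : p ≠ 0)
    (hp : ‖p‖ < 1) (hg : IsGeneric a b q p) {n : ℕ} (tq : ellPoch (q ^ 2) (q ^ 2) (p ^ 2) n ≠ 0)
    (tb : ellPoch (b ^ 2) (q ^ 2) (p ^ 2) n ≠ 0) :
    ∑ k ∈ Finset.range (n + 1), quadTerm a b q p n k = quadValue a b q p n := by
  have hP := norm_sq_lt_one hp
  have hP0 := pow_ne_zero 2 hp0
  have hQ0 := pow_ne_zero 2 hq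
  have tx : ∀ m : ℕ, theta (a * b * (q ^ 2) ^ m) (p ^ 2) ≠ 0 := fun m => by
    simpa using hg.mul m
  have ty' : ∀ m : ℤ, theta (a ^ 2 * (q ^ 2) ^ m) (p ^ 2) ≠ 0 := fun m => by
    rw [← zpow_sq_comm, ← mul_pow, ← theta_mul_theta_neg _ hp, ← neg_mul]
    exact mul_ne_zero (hg.pos m) (hg.neg m)
  have ty : ∀ m : ℕ, theta (a ^ 2 * (q ^ 2) ^ m) (p ^ 2) ≠ 0 := fun m => by simpa using ty' m
  have hxy : a * b / a ^ 2 = b / a := by field_simp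
  have txy : ∀ m : ℤ, theta (a * b / a ^ 2 * (q ^ 2) ^ m) (p ^ 2) ≠ 0 := fun m => by
    rw [hxy, show b / a * (q ^ 2) ^ m = (a / b * (q ^ 2) ^ (-m))⁻¹ by
      rw [zpow_neg, mul_inv, inv_inv, inv_div],
      theta_inv (mul_ne_zero (div_ne_zero ha hb) (zpow_ne_zero _ hQ0)) hP]
    exact div_ne_zero (neg_ne_zero.mpr (hg.div _))
      (mul_ne_zero (div_ne_zero ha hb) (zpow_ne_zero _ hQ0))
  have hexp : ∀ k ∈ Finset.range (n + 1), quadTerm a b q p n k =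
      ∑ j ∈ Finset.range (n + 1),
        innerWeight a b q p j * inversionTerm (a * b) (a ^ 2) (q ^ 2) (p ^ 2) n k j := by
    intro k hk
    have hkn : k ≤ n := by have := Finset.mem_range.mp hk; omega
    have h := sum_innerWeight ha hb hq hp0 hp hg (ellPoch_ne_zero_of_le tq hkn)
      (ellPoch_ne_zero_of_le tb hkn)
    rw [Finset.sum_subset (Finset.range_subset_range.mpr (by omega : k + 1 ≤ n + 1)) (by
      intro j _ hj
      rw [ellPoch_inv_pow_eq_zero hQ0 (by rw [Finset.mem_range] at hj; omega)]
      ring)] at h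
    have c1 : ellPoch (a * b / a ^ 2) (q ^ 2) (p ^ 2) k *
        (ellPoch (a * b / a ^ 2) (q ^ 2) (p ^ 2) k)⁻¹ = 1 :=
      mul_inv_cancel₀ (ellPoch_ne_zero fun j _ => by simpa using txy j)
    have c2 : ellPoch (a ^ 2 * q ^ 2) (q ^ 2) (p ^ 2) k *
        (ellPoch (a ^ 2 * q ^ 2) (q ^ 2) (p ^ 2) k)⁻¹ = 1 :=
      mul_inv_cancel₀ (ellPoch_ne_zero fun j _ => by
        rw [mul_assoc, ← pow_succ']; exact ty (j + 1))
    have pw : (b * q / a) ^ k = (b / (a * q)) ^ k * (q ^ 2) ^ k := by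
      rw [← mul_pow]; congr 1; field_simp
    simp only [inversionTerm, mul_comm (innerWeight a b q p _)]
    simp only [mul_assoc, ← Finset.mul_sum]
    simp only [mul_comm (innerWeight a b q p _)] at h
    simp only [mul_assoc] at h
    rw [h, quadTerm, pw]
    rw [hxy] at c1 ⊢
    refine (one_mul _).symm.trans ?_
    rw [← c1]
    refine (one_mul _).symm.trans ?_
    rw [← c2]
    ring_nf
  rw [Finset.sum_congr rfl hexp, Finset.sum_comm]
  simp only [← Finset.mul_sum]
  rw [Finset.sum_range_succ, Finset.sum_eq_zero fun j hj => by
    rw [sum_inversionTerm (mul_ne_zero ha hb) (pow_ne_zero 2 ha) hQ0 hP0 hP tx ty txy tq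
      (Finset.mem_range.mp hj), mul_zero], zero_add, Finset.sum_range_succ,
    Finset.sum_eq_zero fun k hk => inversionTerm_eq_zero hQ0 (Finset.mem_range.mp hk), zero_add,
    inversionTerm_self (mul_ne_zero ha hb) (pow_ne_zero 2 ha) hQ0 hP tx ty
      (fun m => by simpa using txy m) tq, innerWeight, quadValue,
    show a ^ 2 / (a * b) = a / b by field_simp,
    show a ^ 2 * (q ^ 2) ^ (2 * n) = (a * q ^ (2 * n)) ^ 2 by ring,
    ← theta_mul_theta_neg _ hp, ← theta_mul_theta_neg _ hp, ← ellPoch_mul_neg a _ hp,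
    ← ellPoch_mul_neg q _ hp, ← neg_mul]
  rw [← ellPoch_mul_neg _ _ hp] at tq
  have c1 : theta (-a) p * (theta (-a) p)⁻¹ = 1 := mul_inv_cancel₀ (by simpa using hg.neg 0)
  have c2 : theta (-a * q ^ (2 * n)) p * (theta (-a * q ^ (2 * n)) p)⁻¹ = 1 :=
    mul_inv_cancel₀ (hg.neg (2 * n : ℕ))
  have c3 : ellPoch (-a) q p n * (ellPoch (-a) q p n)⁻¹ = 1 :=
    mul_inv_cancel₀ (ellPoch_ne_zero fun j _ => hg.neg j)
  have c4 := mul_inv_cancel₀ (left_ne_zero_of_mul tq)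
  have c5 := mul_inv_cancel₀ (pow_ne_zero n hq)
  have c6 : ((q ^ 2) ^ n)⁻¹ = (q ^ n)⁻¹ * (q ^ n)⁻¹ := by rw [← mul_inv]; ring
  rw [c6]
  generalize (q ^ n)⁻¹ = u at c5 ⊢
  calc
    _ = (theta (-a) p * (theta (-a) p)⁻¹) *
      (theta (-a * q ^ (2 * n)) p * (theta (-a * q ^ (2 * n)) p)⁻¹) *
      (ellPoch (-a) q p n * (ellPoch (-a) q p n)⁻¹) * (ellPoch q q p n * (ellPoch q q p n)⁻¹) *
      (q ^ n * u) * (theta a p / theta (a * q ^ (2 * n)) p *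
    (ellPoch (-q) q p n * ellPoch (a * q / b) q p n / (ellPoch a q p n * ellPoch (-b) q p n)) *
    (ellPoch (a * b * q ^ 2) (q ^ 2) (p ^ 2) n / ellPoch (a / b) (q ^ 2) (p ^ 2) n) * u) := by ring
    _ = _ := by rw [c1, c2, c3, c4, c5]; ring

/-! ### The quadratic summation in general -/

lemma _root_.ContinuousAt.ellPoch {X : Type*} [TopologicalSpace X] {f g : X → ℂ} {t : X} {q : ℂ}
    (hf : ContinuousAt f t) (hg : ContinuousAt g t) (h0 : f t ≠ 0) (hq : q ≠ 0) (h1 : ‖g t‖ < 1)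
    (n : ℕ) : ContinuousAt (fun s => ellPoch (f s) q (g s) n) t :=
  tendsto_finsetProd _ fun _ _ =>
    (hf.mul continuousAt_const).theta hg (mul_ne_zero h0 (pow_ne_zero _ hq)) h1

/-- The product of all denominators of the quadratic summation. -/
noncomputable def quadDenom (a b q p : ℂ) (n : ℕ) : ℂ :=
  theta (a * b) (p ^ 2) * ellPoch (q ^ 2) (q ^ 2) (p ^ 2) n * ellPoch (b ^ 2) (q ^ 2) (p ^ 2) n *
    ellPoch (a * b * q ^ 2 / (a ^ 2 * (q ^ 2) ^ n)) (q ^ 2) (p ^ 2) n *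
    ellPoch (a * b * (q ^ 2) ^ (n + 1)) (q ^ 2) (p ^ 2) n * ellPoch (a * q) q p (2 * n) *
    theta (a * q ^ (2 * n)) p * ellPoch a q p n * ellPoch (-b) q p n *
    ellPoch (a / b) (q ^ 2) (p ^ 2) n

section Continuity

variable {X : Type*} [TopologicalSpace X] {f g : X → ℂ} {t : X} {b q : ℂ} {n : ℕ}

lemma continuousAt_quadTerm (hf : ContinuousAt f t) (hg : ContinuousAt g t) (h0 : f t ≠ 0)
    (h1 : ‖g t‖ < 1) (hb : b ≠ 0) (hq : q ≠ 0) (hD : quadDenom (f t) b q (g t) n ≠ 0) {k : ℕ}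
    (hk : k ≤ n) : ContinuousAt (fun s => quadTerm (f s) b q (g s) n k) t := by
  have hg2 : ContinuousAt (fun s => g s ^ 2) t := hg.pow 2
  have h2 := norm_sq_lt_one h1
  simp only [quadDenom, mul_ne_zero_iff] at hD
  obtain ⟨⟨⟨⟨⟨⟨⟨⟨⟨d1, d2⟩, d3⟩, d4⟩, d5⟩, d6⟩, -⟩, -⟩, -⟩, -⟩ := hD
  have hc : ∀ c : ℂ, ContinuousAt (fun _ : X => c) t := fun c => continuousAt_const
  have hfb := hf.mul (hc b)
  refine ContinuousAt.mul (ContinuousAt.mul (ContinuousAt.mul (ContinuousAt.div ?_ ?_ ?_)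
    (ContinuousAt.div ?_ ?_ ?_)) (ContinuousAt.div ?_ ?_ ?_)) ?_
  · exact (hfb.mul (hc _)).theta hg2 (by simp [*]) h2
  · exact hfb.theta hg2 (by simp [*]) h2
  · exact d1
  · exact (((hfb.ellPoch hg2 (by simp [*]) (by simp [*]) h2 k).mul
      (((hf.mul (hc _)).div (hc b) hb).ellPoch hg2 (by simp [*]) (by simp [*]) h2 k)).mul
      (((hf.pow 2).mul (hc _)).ellPoch hg2 (by simp [*]) (by simp [*]) h2 k)).mul
      ((hc _).ellPoch hg2 (by simp [*]) (by simp [*]) h2 k)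
  · exact ((((hc _).ellPoch hg2 (by simp [*]) (by simp [*]) h2 k).mul
      ((hc _).ellPoch hg2 (by simp [*]) (by simp [*]) h2 k)).mul
      (((hfb.mul (hc _)).div ((hf.pow 2).mul (hc _)) (by simp [*])).ellPoch hg2 (by simp [*])
        (by simp [*]) h2 k)).mul
      ((hfb.mul (hc _)).ellPoch hg2 (by simp [*]) (by simp [*]) h2 k)
  · exact mul_ne_zero (mul_ne_zero (mul_ne_zero (ellPoch_ne_zero_of_le d2 hk)
      (ellPoch_ne_zero_of_le d3 hk)) (ellPoch_ne_zero_of_le d4 hk)) (ellPoch_ne_zero_of_le d5 hk)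
  · exact (hc b).ellPoch hg hb hq h1 _
  · exact (hf.mul (hc q)).ellPoch hg (by simp [*]) hq h1 _
  · exact ellPoch_ne_zero_of_le d6 (by omega)
  · exact ((hc _).div hf h0).pow k

lemma continuousAt_quadValue (hf : ContinuousAt f t) (hg : ContinuousAt g t) (h0 : f t ≠ 0)
    (h1 : ‖g t‖ < 1) (hb : b ≠ 0) (hq : q ≠ 0) (hD : quadDenom (f t) b q (g t) n ≠ 0) :
    ContinuousAt (fun s => quadValue (f s) b q (g s) n) t := by
  have hg2 : ContinuousAt (fun s => g s ^ 2) t := hg.pow 2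
  have h2 := norm_sq_lt_one h1
  simp only [quadDenom, mul_ne_zero_iff] at hD
  obtain ⟨⟨⟨⟨-, d7⟩, d8⟩, d9⟩, d10⟩ := hD
  have hc : ∀ c : ℂ, ContinuousAt (fun _ : X => c) t := fun c => continuousAt_const
  refine ContinuousAt.mul (ContinuousAt.mul (ContinuousAt.mul (ContinuousAt.div ?_ ?_ ?_)
    (ContinuousAt.div ?_ ?_ ?_)) (ContinuousAt.div ?_ ?_ ?_)) (hc _)
  · exact hf.theta hg h0 h1
  · exact (hf.mul (hc _)).theta hg (by simp [*]) h1
  · exact d7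
  · exact ((hc _).ellPoch hg (neg_ne_zero.mpr hq) hq h1 n).mul
      (((hf.mul (hc _)).div (hc b) hb).ellPoch hg (by simp [*]) hq h1 n)
  · exact (hf.ellPoch hg h0 hq h1 n).mul ((hc _).ellPoch hg (neg_ne_zero.mpr hb) hq h1 n)
  · exact mul_ne_zero d8 d9
  · exact ((hf.mul (hc b)).mul (hc _)).ellPoch hg2 (by simp [*]) (by simp [*]) h2 n
  · exact (hf.div (hc b) hb).ellPoch hg2 (by simp [*]) (by simp [*]) h2 n
  · exact d10

lemma continuousAt_quadDenom (hf : ContinuousAt f t) (hg : ContinuousAt g t) (h0 : f t ≠ 0)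
    (h1 : ‖g t‖ < 1) (hb : b ≠ 0) (hq : q ≠ 0) :
    ContinuousAt (fun s => quadDenom (f s) b q (g s) n) t := by
  have hg2 : ContinuousAt (fun s => g s ^ 2) t := hg.pow 2
  have h2 := norm_sq_lt_one h1
  have hc : ∀ c : ℂ, ContinuousAt (fun _ : X => c) t := fun c => continuousAt_const
  have hfb := hf.mul (hc b)
  refine ContinuousAt.mul (ContinuousAt.mul (ContinuousAt.mul (ContinuousAt.mul (ContinuousAt.mul
    (ContinuousAt.mul (ContinuousAt.mul (ContinuousAt.mul (ContinuousAt.mul ?_ ?_) ?_) ?_) ?_) ?_)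
    ?_) ?_) ?_) ?_
  · exact hfb.theta hg2 (by simp [*]) h2
  · exact (hc _).ellPoch hg2 (by simp [*]) (by simp [*]) h2 n
  · exact (hc _).ellPoch hg2 (by simp [*]) (by simp [*]) h2 n
  · exact ((hfb.mul (hc _)).div ((hf.pow 2).mul (hc _)) (by simp [*])).ellPoch hg2 (by simp [*])
      (by simp [*]) h2 n
  · exact (hfb.mul (hc _)).ellPoch hg2 (by simp [*]) (by simp [*]) h2 n
  · exact (hf.mul (hc q)).ellPoch hg (by simp [*]) hq h1 _
  · exact (hf.mul (hc _)).theta hg (by simp [*]) h1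
  · exact hf.ellPoch hg h0 hq h1 n
  · exact (hc _).ellPoch hg (neg_ne_zero.mpr hb) hq h1 n
  · exact (hf.div (hc b) hb).ellPoch hg2 (by simp [*]) (by simp [*]) h2 n

end Continuity

/-- Only countably many values of `a` are excluded by `IsGeneric`. -/
lemma dense_isGeneric {b q p : ℂ} (hb : b ≠ 0) (hq : q ≠ 0) (hp0 : p ≠ 0) (hp : ‖p‖ < 1) :
    Dense {a : ℂ | a ≠ 0 ∧ IsGeneric a b q p} := by
  have hP0 := pow_ne_zero 2 hp0
  have hP := norm_sq_lt_one hp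
  have hq' : ∀ m : ℤ, q ^ m ≠ 0 := fun m => zpow_ne_zero m hq
  have hQ' : ∀ m : ℤ, (q ^ 2) ^ m ≠ 0 := fun m => zpow_ne_zero m (pow_ne_zero 2 hq)
  let S : Set ℂ := {0} ∪ Set.range (fun z : ℤ × ℤ => p ^ z.2 / q ^ z.1) ∪
    Set.range (fun z : ℤ × ℤ => -(p ^ z.2 / q ^ z.1)) ∪
    Set.range (fun z : ℤ × ℤ => (p ^ 2) ^ z.2 / (b * (q ^ 2) ^ z.1)) ∪
    Set.range (fun z : ℤ × ℤ => (p ^ 2) ^ z.2 / (q ^ 2) ^ z.1 * b)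
  have hS : S.Countable := ((((Set.countable_singleton 0).union (Set.countable_range _)).union
    (Set.countable_range _)).union (Set.countable_range _)).union (Set.countable_range _)
  refine (hS.dense_compl ℂ).mono fun a ha => ?_
  simp only [S, Set.mem_compl_iff, Set.mem_union, Set.mem_singleton_iff, Set.mem_range, not_or,
    not_exists, Prod.forall] at ha
  obtain ⟨⟨⟨⟨h0, h1⟩, h2⟩, h3⟩, h4⟩ := ha
  refine ⟨h0, fun m => ?_, fun m => ?_, fun m => ?_, fun m => ?_⟩
  · refine theta_ne_zero (mul_ne_zero h0 (hq' m)) hp0 hp fun l h => h1 m l ?_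
    rw [← h, mul_div_cancel_right₀ _ (hq' m)]
  · refine theta_ne_zero (mul_ne_zero (neg_ne_zero.mpr h0) (hq' m)) hp0 hp fun l h => h2 m l ?_
    rw [← h, mul_div_cancel_right₀ _ (hq' m), neg_neg]
  · refine theta_ne_zero (mul_ne_zero (mul_ne_zero h0 hb) (hQ' m)) hP0 hP fun l h => h3 m l ?_
    rw [← h, mul_assoc, mul_div_cancel_right₀ _ (mul_ne_zero hb (hQ' m))]
  · refine theta_ne_zero (mul_ne_zero (div_ne_zero h0 hb) (hQ' m)) hP0 hP fun l h => h4 m l ?_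
    rw [← h, mul_div_cancel_right₀ _ (hQ' m), div_mul_cancel₀ _ hb]

/-- The quadratic summation: both sides are continuous in `a`, and generic `a` are dense. -/
theorem sum_quadTerm {a b q p : ℂ} (ha : a ≠ 0) (hb : b ≠ 0) (hq : q ≠ 0) (hp0 : p ≠ 0)
    (hp : ‖p‖ < 1) {n : ℕ} (hD : quadDenom a b q p n ≠ 0) :
    ∑ k ∈ Finset.range (n + 1), quadTerm a b q p n k = quadValue a b q p n := by
  have h1 : ContinuousAt (fun s => ∑ k ∈ Finset.range (n + 1), quadTerm s b q p n k) a :=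
    tendsto_finsetSum _ fun k hk => continuousAt_quadTerm (f := id) (g := fun _ => p)
      continuousAt_id continuousAt_const ha hp hb hq hD (by have := Finset.mem_range.mp hk; omega)
  have h2 : ContinuousAt (fun s => quadValue s b q p n) a :=
    continuousAt_quadValue (f := id) (g := fun _ => p) continuousAt_id continuousAt_const ha hp hb
      hq hD
  simp only [quadDenom, mul_ne_zero_iff] at hD
  obtain ⟨⟨⟨⟨⟨⟨⟨⟨⟨-, d2⟩, d3⟩, -⟩, -⟩, -⟩, -⟩, -⟩, -⟩, -⟩ := hD
  refine tendsto_nhds_unique_of_frequently_eq h1 h2 ?_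
  refine (mem_closure_iff_frequently.mp (dense_isGeneric hb hq hp0 hp a)).mono fun s hs => ?_
  exact sum_quadTerm_of_isGeneric hs.1 hb hq hp0 hp hs.2 d2 d3

/-! ### The elliptic series in terms of the quadratic sum -/

lemma ellPoch_mul_base (x : ℂ) {q p : ℂ} (hp0 : p ≠ 0) (hp : ‖p‖ < 1) (n : ℕ) :
    ellPoch x q (p ^ 2) n * ellPoch (x * p) q (p ^ 2) n = ellPoch x q p n := by
  rw [ellPoch, ellPoch, ← Finset.prod_mul_distrib, ellPoch]
  refine Finset.prod_congr rfl fun j _ => ?_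
  rw [mul_right_comm, theta_sq_mul hp0 hp]

lemma ellPoch_div_sq {x q p : ℂ} (hx : x ≠ 0) (hq : q ≠ 0) (hp0 : p ≠ 0) (hp : ‖p‖ < 1) (n : ℕ) :
    ellPoch (x / p) q (p ^ 2) n =
      (-(x / p)) ^ n * q ^ n.choose 2 * ellPoch (x * p) q (p ^ 2) n := by
  rw [← prod_const_mul_pow, ellPoch, ellPoch, ← Finset.prod_mul_distrib]
  refine Finset.prod_congr rfl fun j _ => ?_
  rw [div_mul_eq_mul_div, theta_div_sq (mul_ne_zero hx (pow_ne_zero j hq)) hp0 hp,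
    mul_right_comm x p]
  ring

lemma ellPoch_div_base {x q p : ℂ} (hx : x ≠ 0) (hq : q ≠ 0) (hp0 : p ≠ 0) (hp : ‖p‖ < 1) (n : ℕ) :
    ellPoch (x / p) q p n = (-(x / p)) ^ n * q ^ n.choose 2 * ellPoch x q p n := by
  rw [← prod_const_mul_pow, ellPoch, ellPoch, ← Finset.prod_mul_distrib]
  refine Finset.prod_congr rfl fun j _ => ?_
  rw [div_mul_eq_mul_div, theta_div_right (mul_ne_zero hx (pow_ne_zero j hq)) hp0 hp]
  ring

lemma ellPoch_shift_base {x q p : ℂ} (hx : x ≠ 0) (hq : q ≠ 0) (hp0 : p ≠ 0) (hp : ‖p‖ < 1)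
    (n : ℕ) : ellPoch x q p n = (-x) ^ n * q ^ n.choose 2 * ellPoch (x * p) q p n := by
  have := ellPoch_div_base (mul_ne_zero hx hp0) hq hp0 hp n
  rwa [mul_div_cancel_right₀ _ hp0] at this

lemma zpow_neg_two_mul_natCast (q : ℂ) (n : ℕ) : q ^ (-2 * (n : ℤ)) = ((q ^ 2) ^ n)⁻¹ := by
  rw [neg_mul, zpow_neg, zpow_mul, zpow_natCast]; rfl

lemma ellVTerm_eq_quadTerm {a b q p : ℂ} (ha : a ≠ 0) (hb : b ≠ 0) (hq : q ≠ 0) (hp0 : p ≠ 0)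
    (hp : ‖p‖ < 1) (n k : ℕ) :
    ellVTerm (a * b) [b, b * q, b / p, b * q * p, a * q ^ 2 / b,
          a ^ 2 * q ^ (2 * n), q ^ (-2 * (n : ℤ))] (q ^ 2) (p ^ 2) k = quadTerm a b q p n k := by
  have hQ0 := pow_ne_zero 2 hq
  rw [zpow_neg_two_mul_natCast, pow_mul q 2 n]
  simp only [ellVTerm, ellPochs, List.map_cons, List.map_nil, List.prod_cons, List.prod_nil,
    mul_one]
  rw [show a * b * q ^ 2 / b = a * q * q by field_simp,
    show a * b * q ^ 2 / (b * q) = a * q by field_simp,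
    show a * b * q ^ 2 / (b / p) = a * q * q * p by field_simp,
    show a * b * q ^ 2 / (b * q * p) = a * q / p by field_simp,
    show a * b * q ^ 2 / (a * q ^ 2 / b) = b ^ 2 by field_simp,
    show a * b * q ^ 2 / ((q ^ 2) ^ n)⁻¹ = a * b * (q ^ 2) ^ (n + 1) by field_simp; ring,
    ellPoch_div_sq hb hQ0 hp0 hp, ellPoch_div_sq (mul_ne_zero ha hq) hQ0 hp0 hp, quadTerm,
    ← ellPoch_sq_mul b, ← ellPoch_sq_mul (a * q), ← ellPoch_mul_base b hp0 hp,
    ← ellPoch_mul_base (b * q) hp0 hp, ← ellPoch_mul_base (a * q) hp0 hp,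
    ← ellPoch_mul_base (a * q * q) hp0 hp]
  have pw : (b * q / a) ^ k = (-(b / p)) ^ k / (-(a * q / p)) ^ k * (q ^ 2) ^ k := by
    rw [← div_pow, ← mul_pow]; congr 1; field_simp
  have c := mul_inv_cancel₀ (pow_ne_zero (k.choose 2) hQ0)
  rw [pw]
  generalize (-(b / p)) ^ k = u1
  generalize (-(a * q / p)) ^ k = u2
  generalize (q ^ 2) ^ k.choose 2 = u3 at c ⊢
  symm
  refine (one_mul _).symm.trans ?_
  rw [← c]
  ring

lemma quadTerm_eq_zero {a b q p : ℂ} (hq : q ≠ 0) {n k : ℕ} (hk : n < k) :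
    quadTerm a b q p n k = 0 := by
  simp [quadTerm, ellPoch_inv_pow_eq_zero (pow_ne_zero 2 hq) hk]

lemma ellV_eq_sum_quadTerm {a b q p : ℂ} (ha : a ≠ 0) (hb : b ≠ 0) (hq : q ≠ 0) (hp0 : p ≠ 0)
    (hp : ‖p‖ < 1) (n : ℕ) :
    ellV (a * b) [b, b * q, b / p, b * q * p, a * q ^ 2 / b,
          a ^ 2 * q ^ (2 * n), q ^ (-2 * (n : ℤ))] (q ^ 2) (p ^ 2) =
      ∑ k ∈ Finset.range (n + 1), quadTerm a b q p n k := by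
  rw [ellV]
  simp only [ellVTerm_eq_quadTerm ha hb hq hp0 hp]
  exact tsum_eq_sum fun k hk => quadTerm_eq_zero hq (by rw [Finset.mem_range] at hk; omega)

lemma closedForm_eq_quadValue (a b q p : ℂ) (n : ℕ) :
    theta a p / theta (a * q ^ (2 * n)) p *
      (ellPochs [-q, a * q / b] q p n / ellPochs [a, -b] q p n) *
      (ellPoch (a * b * q ^ 2) (q ^ 2) (p ^ 2) n / ellPoch (a / b) (q ^ 2) (p ^ 2) n) *
      q ^ (-(n : ℤ)) = quadValue a b q p n := by
  simp [quadValue, ellPochs]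

/-! ### The limit `p → 0` -/

lemma ellPoch_zero_right (x q : ℂ) (n : ℕ) : ellPoch x q 0 n = qPoch x q n := by
  simp [ellPoch, qPoch, theta_zero_right]

lemma qW_eq_sum_quadTerm {a b q : ℂ} (ha : a ≠ 0) (hb : b ≠ 0) (hq : q ≠ 0) (n : ℕ) :
    qW (a * b) [b, b * q, a * q ^ 2 / b, a ^ 2 * q ^ (2 * n), q ^ (-2 * (n : ℤ))] (q ^ 2)
        (b * q / a) = ∑ k ∈ Finset.range (n + 1), quadTerm a b q 0 n k := by
  have h : ∀ k ∉ Finset.range (n + 1), quadTerm a b q 0 n k = 0 := fun k hk =>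
    quadTerm_eq_zero hq (by rw [Finset.mem_range] at hk; omega)
  have h' : ∑' k, quadTerm a b q 0 n k = _ := tsum_eq_sum h
  rw [← h', qW]
  congr 1
  ext k
  rw [quadTerm, zpow_neg_two_mul_natCast, pow_mul q 2 n, ← ellPoch_sq_mul b,
    ← ellPoch_sq_mul (a * q)]
  simp only [zero_pow two_ne_zero, ellPoch_zero_right, theta_zero_right, qPochs, List.map_cons,
    List.map_nil, List.prod_cons, List.prod_nil, mul_one]
  rw [show a * b * q ^ 2 / b = a * q * q by field_simp,
    show a * b * q ^ 2 / (b * q) = a * q by field_simp,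
    show a * b * q ^ 2 / (a * q ^ 2 / b) = b ^ 2 by field_simp,
    show a * b * q ^ 2 / ((q ^ 2) ^ n)⁻¹ = a * b * (q ^ 2) ^ (n + 1) by field_simp; ring]
  ring

lemma eventually_punctured_norm_lt_one : ∀ᶠ p : ℂ in 𝓝[≠] 0, p ≠ 0 ∧ ‖p‖ < 1 :=
  Eventually.and self_mem_nhdsWithin (((continuous_norm.tendsto (0 : ℂ)).mono_left
    nhdsWithin_le_nhds).eventually (gt_mem_nhds (by simp)))

lemma mul_zpow_two_sub_div {a b q : ℂ} (ha : a ≠ 0) (hq : q ≠ 0) {n : ℕ} :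
    b * q ^ (2 - 2 * (n : ℤ)) / a = a * b * q ^ 2 / (a ^ 2 * (q ^ 2) ^ n) := by
  rw [zpow_sub₀ hq, zpow_mul, zpow_natCast]
  field_simp

/-- The basic denominators, in terms of `quadDenom` at `p = 0`. -/
lemma quadDenom_zero_ne_zero {a b q : ℂ} (ha : a ≠ 0) {n : ℕ} (h1 : 1 - a * b ≠ 0)
    (h2 : qPochs [q ^ 2, a * q ^ 2, a * q, b ^ 2, b * q ^ (2 - 2 * (n : ℤ)) / a,
      a * b * q ^ (2 * n + 2)] (q ^ 2) n ≠ 0) (hq : q ≠ 0)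
    (h3 : 1 - a * q ^ (2 * n) ≠ 0) (h4 : qPochs [a, -b] q n ≠ 0)
    (h5 : qPoch (a / b) (q ^ 2) n ≠ 0) : quadDenom a b q 0 n ≠ 0 := by
  rw [mul_zpow_two_sub_div ha hq,
    show a * b * q ^ (2 * n + 2) = a * b * (q ^ 2) ^ (n + 1) by ring] at h2
  simp only [qPochs, List.map_cons, List.map_nil, List.prod_cons, List.prod_nil, mul_one,
    mul_ne_zero_iff] at h2 h4
  obtain ⟨e1, e2, e3, e4, e5, e6⟩ := h2
  rw [quadDenom, ← ellPoch_sq_mul (a * q), show a * q * q = a * q ^ 2 by ring]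
  simp only [zero_pow two_ne_zero, ellPoch_zero_right, theta_zero_right, mul_ne_zero_iff]
  tauto

/-! ### The balanced `₄φ₃` sum -/

lemma two_mul_choose_two (k : ℕ) : (2 * k).choose 2 = 4 * k.choose 2 + k := by
  induction k with
  | zero => rfl
  | succ k ih =>
    rw [show 2 * (k + 1) = 2 * k + 1 + 1 by ring, Nat.choose_succ_succ' _ 1,
      Nat.choose_succ_succ' _ 1, ih, Nat.choose_succ_succ' k 1]
    simp only [Nat.choose_one_right]
    ring

/-- The term of the quadratic sum at `b p`: by quasi-periodicity all powers of `p` cancel. -/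
lemma quadTerm_mul_base {a b q p : ℂ} (ha : a ≠ 0) (hb : b ≠ 0) (hq : q ≠ 0) (hp0 : p ≠ 0)
    (hp : ‖p‖ < 1) (n k : ℕ) :
    quadTerm a (b * p) q p n k =
      theta (a * b * (q ^ 2) ^ (2 * k) * p) (p ^ 2) / theta (a * b * p) (p ^ 2) *
      (ellPoch (a * b * p) (q ^ 2) (p ^ 2) k * ellPoch (a * q ^ 2 / b * p) (q ^ 2) (p ^ 2) k *
          ellPoch (a ^ 2 * (q ^ 2) ^ n) (q ^ 2) (p ^ 2) k *
          ellPoch ((q ^ 2) ^ n)⁻¹ (q ^ 2) (p ^ 2) k /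
        (ellPoch (q ^ 2) (q ^ 2) (p ^ 2) k * ellPoch (b ^ 2) (q ^ 2) (p ^ 2) k *
          ellPoch (a * b * q ^ 2 / (a ^ 2 * (q ^ 2) ^ n) * p) (q ^ 2) (p ^ 2) k *
          ellPoch (a * b * (q ^ 2) ^ (n + 1) * p) (q ^ 2) (p ^ 2) k)) *
      (ellPoch b q p (2 * k) / ellPoch (a * q) q p (2 * k)) * (q ^ 2) ^ k := by
  have hQ0 := pow_ne_zero 2 hq
  have hb2 := pow_ne_zero 2 hb
  have pw : (-(a * q ^ 2 / b / p)) ^ k * (q ^ 2) ^ k.choose 2 * (b * p * q / a) ^ k =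
      (-b) ^ (2 * k) * q ^ (2 * k).choose 2 / ((-b ^ 2) ^ k * (q ^ 2) ^ k.choose 2) *
        (q ^ 2) ^ k := by
    have e1 : (-(a * q ^ 2 / b / p)) ^ k * (b * p * q / a) ^ k =
        (-b) ^ (2 * k) * q ^ k / (-b ^ 2) ^ k * (q ^ 2) ^ k := by
      rw [pow_mul, ← mul_pow, ← mul_pow, ← div_pow, ← mul_pow]; congr 1; field_simp
    have e2 : (q ^ 2) ^ k.choose 2 * q ^ k = q ^ (2 * k).choose 2 / (q ^ 2) ^ k.choose 2 := by
      rw [two_mul_choose_two, eq_div_iff (by positivity)]; ring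
    calc
      _ = ((-(a * q ^ 2 / b / p)) ^ k * (b * p * q / a) ^ k) * (q ^ 2) ^ k.choose 2 := by ring
      _ = (-b) ^ (2 * k) * ((q ^ 2) ^ k.choose 2 * q ^ k) / (-b ^ 2) ^ k * (q ^ 2) ^ k := by
        rw [e1]; ring
      _ = _ := by rw [e2]; ring
  rw [quadTerm, ellPoch_shift_base hb hq hp0 hp (2 * k),
    ellPoch_shift_base (x := b ^ 2) hb2 hQ0 (pow_ne_zero 2 hp0) (norm_sq_lt_one hp),
    show a * q ^ 2 / (b * p) = a * q ^ 2 / b / p by rw [div_div],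
    ellPoch_div_sq (x := a * q ^ 2 / b) (by positivity) hQ0 hp0 hp,
    show (b * p) ^ 2 = b ^ 2 * p ^ 2 by ring,
    show a * (b * p) * (q ^ 2) ^ (2 * k) = a * b * (q ^ 2) ^ (2 * k) * p by ring,
    show a * (b * p) * (q ^ 2) ^ (n + 1) = a * b * (q ^ 2) ^ (n + 1) * p by ring,
    show a * (b * p) * q ^ 2 / (a ^ 2 * (q ^ 2) ^ n) =
      a * b * q ^ 2 / (a ^ 2 * (q ^ 2) ^ n) * p by ring,
    show a * (b * p) = a * b * p by ring]
  generalize (-(a * q ^ 2 / b / p)) ^ k = u1 at *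
  generalize (b * p * q / a) ^ k = u2 at *
  generalize (-b) ^ (2 * k) = u3 at *
  generalize q ^ (2 * k).choose 2 = u4 at *
  generalize (-b ^ 2) ^ k = u5 at *
  generalize (q ^ 2) ^ k.choose 2 = u6 at *
  generalize (q ^ 2) ^ k = u7 at *
  generalize theta (a * b * (q ^ 2) ^ (2 * k) * p) (p ^ 2) / theta (a * b * p) (p ^ 2) = t
  calc
    _ = (u1 * u6 * u2) * (t * (ellPoch (a * b * p) (q ^ 2) (p ^ 2) k *
          ellPoch (a * q ^ 2 / b * p) (q ^ 2) (p ^ 2) k *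
          ellPoch (a ^ 2 * (q ^ 2) ^ n) (q ^ 2) (p ^ 2) k *
          ellPoch ((q ^ 2) ^ n)⁻¹ (q ^ 2) (p ^ 2) k /
        (ellPoch (q ^ 2) (q ^ 2) (p ^ 2) k * ellPoch (b ^ 2 * p ^ 2) (q ^ 2) (p ^ 2) k *
          ellPoch (a * b * q ^ 2 / (a ^ 2 * (q ^ 2) ^ n) * p) (q ^ 2) (p ^ 2) k *
          ellPoch (a * b * (q ^ 2) ^ (n + 1) * p) (q ^ 2) (p ^ 2) k)) *
      (ellPoch (b * p) q p (2 * k) / ellPoch (a * q) q p (2 * k))) := by ring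
    _ = _ := by rw [pw]; ring

/-- The closed form at `b p`: here, too, all powers of `p` cancel. -/
lemma quadValue_mul_base {a b q p : ℂ} (ha : a ≠ 0) (hb : b ≠ 0) (hq : q ≠ 0) (hp0 : p ≠ 0)
    (hp : ‖p‖ < 1) (n : ℕ) :
    quadValue a (b * p) q p n = theta a p / theta (a * q ^ (2 * n)) p *
      (ellPoch (-q) q p n * ellPoch (a * q / b) q p n / (ellPoch a q p n * ellPoch (-b) q p n)) *
      (ellPoch (a * b * q ^ 2 * p) (q ^ 2) (p ^ 2) n /
        ellPoch (a / b * p) (q ^ 2) (p ^ 2) n) * b ^ n := by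
  have hQ0 := pow_ne_zero 2 hq
  have pw : (-(a * q / b / p)) ^ n / (-(a / b / p)) ^ n * (q ^ n)⁻¹ = 1 := by
    rw [← div_pow, ← inv_pow, ← mul_pow]
    convert one_pow n using 2
    field_simp
  have c := mul_inv_cancel₀ (pow_ne_zero (n.choose 2) hq)
  have c' := mul_inv_cancel₀ (pow_ne_zero n hb)
  rw [quadValue, ellPoch_shift_base (x := -b) (by simpa using hb) hq hp0 hp, neg_neg,
    show a * q / (b * p) = a * q / b / p by rw [div_div],
    ellPoch_div_base (x := a * q / b) (by positivity) hq hp0 hp,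
    show a / (b * p) = a / b / p by rw [div_div],
    ellPoch_div_sq (x := a / b) (by positivity) hQ0 hp0 hp,
    show a * (b * p) * q ^ 2 = a * b * q ^ 2 * p by ring, ← neg_mul,
    show (q ^ 2) ^ n.choose 2 = (q ^ n.choose 2) ^ 2 by ring]
  generalize (-(a * q / b / p)) ^ n = u1 at *
  generalize (-(a / b / p)) ^ n = u2 at *
  generalize (q ^ n)⁻¹ = u3 at *
  generalize q ^ n.choose 2 = u4 at *
  generalize theta a p / theta (a * q ^ (2 * n)) p = t
  calc
    _ = (u4 * u4⁻¹) * (u1 / u2 * u3) * (t * (ellPoch (-q) q p n * ellPoch (a * q / b) q p n /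
      (ellPoch a q p n * (u4 * ellPoch (-b * p) q p n))) *
      (ellPoch (a * b * q ^ 2 * p) (q ^ 2) (p ^ 2) n /
        ellPoch (a / b * p) (q ^ 2) (p ^ 2) n)) := by ring
    _ = (b ^ n * (b ^ n)⁻¹) * (t * (ellPoch (-q) q p n * ellPoch (a * q / b) q p n /
      (ellPoch a q p n * (u4 * ellPoch (-b * p) q p n))) *
      (ellPoch (a * b * q ^ 2 * p) (q ^ 2) (p ^ 2) n /
        ellPoch (a / b * p) (q ^ 2) (p ^ 2) n)) := by rw [pw, c, c']; ring
    _ = _ := by ring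

lemma tendsto_theta_const {c : ℂ} (hc : c ≠ 0) :
    Tendsto (fun p : ℂ => theta c p) (𝓝[≠] 0) (𝓝 (1 - c)) := by
  have : ContinuousAt (fun p : ℂ => theta c p) 0 :=
    continuousAt_const.theta continuousAt_id hc (by simp)
  have h := this.tendsto.mono_left (nhdsWithin_le_nhds (s := {0}ᶜ))
  rwa [theta_zero_right] at h

lemma tendsto_ellPoch_const {c q : ℂ} (hc : c ≠ 0) (hq : q ≠ 0) (n : ℕ) :
    Tendsto (fun p : ℂ => ellPoch c q p n) (𝓝[≠] 0) (𝓝 (qPoch c q n)) :=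
  tendsto_finsetProd _ fun _ _ => tendsto_theta_const (mul_ne_zero hc (pow_ne_zero _ hq))

lemma tendsto_ellPoch_const_sq {c q : ℂ} (hc : c ≠ 0) (hq : q ≠ 0) (n : ℕ) :
    Tendsto (fun p : ℂ => ellPoch c q (p ^ 2) n) (𝓝[≠] 0) (𝓝 (qPoch c q n)) := by
  have : ContinuousAt (fun p : ℂ => ellPoch c q (p ^ 2) n) 0 :=
    continuousAt_const.ellPoch (continuousAt_id.pow 2) hc hq (by simp) n
  have h := this.tendsto.mono_left (nhdsWithin_le_nhds (s := {0}ᶜ))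
  rwa [zero_pow two_ne_zero, ellPoch_zero_right] at h

lemma tendsto_ellPoch_mul_sq {c q : ℂ} (hc : c ≠ 0) (hq : q ≠ 0) (n : ℕ) :
    Tendsto (fun p : ℂ => ellPoch (c * p) q (p ^ 2) n) (𝓝[≠] 0) (𝓝 1) := by
  have h := tendsto_finsetProd (Finset.range n)
    (f := fun (j : ℕ) (p : ℂ) => theta (c * q ^ j * p) (p ^ 2)) (a := fun _ => 1)
    fun j _ => tendsto_theta_mul_sq (c * q ^ j) (mul_ne_zero hc (pow_ne_zero _ hq))
  rw [Finset.prod_const_one] at h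
  refine h.congr fun p => ?_
  rw [ellPoch]
  exact Finset.prod_congr rfl fun j _ => by rw [mul_right_comm]

lemma qPoch_sq_mul (x q : ℂ) (n : ℕ) :
    qPoch x (q ^ 2) n * qPoch (x * q) (q ^ 2) n = qPoch x q (2 * n) := by
  simp only [← ellPoch_zero_right, ellPoch_sq_mul]

lemma qPoch_ne_zero_of_le {x q : ℂ} {n k : ℕ} (h : qPoch x q n ≠ 0) (hk : k ≤ n) :
    qPoch x q k ≠ 0 := by
  rw [← ellPoch_zero_right] at h ⊢
  exact ellPoch_ne_zero_of_le h hk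

/-- The balanced `₄φ₃` sum as the limit `p → 0` of the quadratic summation at `b p`. -/
theorem sum_balanced {a b q : ℂ} (ha : a ≠ 0) (hb : b ≠ 0) (hq : q ≠ 0) {n : ℕ}
    (h1 : qPoch (q ^ 2) (q ^ 2) n ≠ 0) (h2 : qPoch (b ^ 2) (q ^ 2) n ≠ 0)
    (h3 : qPoch (a * q) q (2 * n) ≠ 0) (h4 : 1 - a * q ^ (2 * n) ≠ 0) (h5 : qPoch a q n ≠ 0)
    (h6 : qPoch (-b) q n ≠ 0) :
    ∑ k ∈ Finset.range (n + 1), qPoch (a ^ 2 * (q ^ 2) ^ n) (q ^ 2) k *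
        qPoch ((q ^ 2) ^ n)⁻¹ (q ^ 2) k / (qPoch (q ^ 2) (q ^ 2) k * qPoch (b ^ 2) (q ^ 2) k) *
        (qPoch b q (2 * k) / qPoch (a * q) q (2 * k)) * (q ^ 2) ^ k =
      (1 - a) / (1 - a * q ^ (2 * n)) *
        (qPoch (-q) q n * qPoch (a * q / b) q n / (qPoch a q n * qPoch (-b) q n)) * b ^ n := by
  have hQ0 := pow_ne_zero 2 hq
  have hb2 := pow_ne_zero 2 hb
  have hab := mul_ne_zero ha hb
  have hbn := neg_ne_zero.mpr hb
  have hqn := neg_ne_zero.mpr hq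
  have haq := mul_ne_zero ha hq
  have hterm : ∀ k ∈ Finset.range (n + 1), Tendsto (fun p => quadTerm a (b * p) q p n k) (𝓝[≠] 0)
      (𝓝 (qPoch (a ^ 2 * (q ^ 2) ^ n) (q ^ 2) k *
        qPoch ((q ^ 2) ^ n)⁻¹ (q ^ 2) k / (qPoch (q ^ 2) (q ^ 2) k * qPoch (b ^ 2) (q ^ 2) k) *
        (qPoch b q (2 * k) / qPoch (a * q) q (2 * k)) * (q ^ 2) ^ k)) := by
    intro k hk
    have hkn : k ≤ n := by have := Finset.mem_range.mp hk; omega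
    have t1 := (tendsto_theta_mul_sq (a * b * (q ^ 2) ^ (2 * k)) (by positivity)).div
      (tendsto_theta_mul_sq (a * b) hab) one_ne_zero
    have t2 := (((tendsto_ellPoch_mul_sq hab hQ0 k).mul (tendsto_ellPoch_mul_sq
      (c := a * q ^ 2 / b) (by positivity) hQ0 k)).mul (tendsto_ellPoch_const_sq
      (c := a ^ 2 * (q ^ 2) ^ n) (by positivity) hQ0 k)).mul (tendsto_ellPoch_const_sq
      (c := ((q ^ 2) ^ n)⁻¹) (by positivity) hQ0 k)
    have t3 := (((tendsto_ellPoch_const_sq hQ0 hQ0 k).mul (tendsto_ellPoch_const_sq hb2 hQ0 k)).mul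
      (tendsto_ellPoch_mul_sq (c := a * b * q ^ 2 / (a ^ 2 * (q ^ 2) ^ n)) (by positivity)
        hQ0 k)).mul (tendsto_ellPoch_mul_sq (c := a * b * (q ^ 2) ^ (n + 1)) (by positivity) hQ0 k)
    have t4 := (tendsto_ellPoch_const hb hq (2 * k)).div (tendsto_ellPoch_const haq hq (2 * k))
      (qPoch_ne_zero_of_le h3 (by omega))
    have n1 := qPoch_ne_zero_of_le h1 hkn
    have n2 := qPoch_ne_zero_of_le h2 hkn
    have t := ((t1.mul (t2.div t3 (by simp [n1, n2]))).mul t4).mul_const ((q ^ 2) ^ k)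
    simp only [div_one, one_mul, mul_one] at t
    refine t.congr' ?_
    filter_upwards [eventually_punctured_norm_lt_one] with p hp
    exact (quadTerm_mul_base ha hb hq hp.1 hp.2 n k).symm
  have hval : Tendsto (fun p => quadValue a (b * p) q p n) (𝓝[≠] 0)
      (𝓝 ((1 - a) / (1 - a * q ^ (2 * n)) *
        (qPoch (-q) q n * qPoch (a * q / b) q n / (qPoch a q n * qPoch (-b) q n)) * b ^ n)) := by
    have t1 := (tendsto_theta_const ha).div (tendsto_theta_const (c := a * q ^ (2 * n))
      (by positivity)) h4
    have t2 := ((tendsto_ellPoch_const hqn hq n).mul (tendsto_ellPoch_const (c := a * q / b)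
      (by positivity) hq n)).div ((tendsto_ellPoch_const ha hq n).mul
        (tendsto_ellPoch_const hbn hq n)) (mul_ne_zero h5 h6)
    have t3 := (tendsto_ellPoch_mul_sq (c := a * b * q ^ 2) (by positivity) hQ0 n).div
      (tendsto_ellPoch_mul_sq (c := a / b) (by positivity) hQ0 n) one_ne_zero
    have t := ((t1.mul t2).mul t3).mul_const (b ^ n)
    simp only [div_one, mul_one] at t
    refine t.congr' ?_
    filter_upwards [eventually_punctured_norm_lt_one] with p hp
    exact (quadValue_mul_base ha hb hq hp.1 hp.2 n).symm
  refine tendsto_nhds_unique_of_eventuallyEq (tendsto_finsetSum _ hterm) hval ?_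
  filter_upwards [eventually_punctured_norm_lt_one,
    (tendsto_theta_mul_sq (a * b) hab).eventually_ne one_ne_zero,
    (tendsto_ellPoch_const_sq hQ0 hQ0 n).eventually_ne h1,
    (tendsto_ellPoch_const_sq hb2 hQ0 n).eventually_ne h2,
    (tendsto_ellPoch_mul_sq (c := a * b * q ^ 2 / (a ^ 2 * (q ^ 2) ^ n)) (by positivity)
      hQ0 n).eventually_ne one_ne_zero,
    (tendsto_ellPoch_mul_sq (c := a * b * (q ^ 2) ^ (n + 1)) (by positivity)
      hQ0 n).eventually_ne one_ne_zero,
    (tendsto_ellPoch_const haq hq (2 * n)).eventually_ne h3,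
    (tendsto_theta_const (c := a * q ^ (2 * n)) (by positivity)).eventually_ne h4,
    (tendsto_ellPoch_const ha hq n).eventually_ne h5,
    (tendsto_ellPoch_const hbn hq n).eventually_ne h6,
    (tendsto_ellPoch_mul_sq (c := a / b) (by positivity) hQ0 n).eventually_ne one_ne_zero]
    with p ⟨hp0, hp⟩ e1 e2 e3 e4 e5 e6 e7 e8 e9 e10
  -- for small `p`, no denominator of the quadratic summation at `b p` vanishes
  refine sum_quadTerm ha (mul_ne_zero hb hp0) hq hp0 hp ?_
  rw [ellPoch_shift_base hb2 hQ0 (pow_ne_zero 2 hp0) (norm_sq_lt_one hp)] at e3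
  rw [ellPoch_shift_base hbn hq hp0 hp] at e9
  rw [quadDenom, show a * (b * p) * q ^ 2 / (a ^ 2 * (q ^ 2) ^ n) =
      a * b * q ^ 2 / (a ^ 2 * (q ^ 2) ^ n) * p by ring,
    show a * (b * p) * (q ^ 2) ^ (n + 1) = a * b * (q ^ 2) ^ (n + 1) * p by ring,
    show a * (b * p) = a * b * p by ring, show (b * p) ^ 2 = b ^ 2 * p ^ 2 by ring,
    show -(b * p) = -b * p by ring, show a / (b * p) = a / b / p by rw [div_div],
    ellPoch_div_sq (x := a / b) (by positivity) hQ0 hp0 hp]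
  exact mul_ne_zero (mul_ne_zero (mul_ne_zero (mul_ne_zero (mul_ne_zero (mul_ne_zero (mul_ne_zero
    (mul_ne_zero (mul_ne_zero e1 e2) (right_ne_zero_of_mul e3)) e4) e5) e6) e7) e8)
    (right_ne_zero_of_mul e9)) (mul_ne_zero (mul_ne_zero (pow_ne_zero _ (neg_ne_zero.mpr
      (by positivity))) (by positivity)) e10)

/-! ### Both sides in the notation of the theorem -/

lemma qClosedForm_eq_quadValue (a b q : ℂ) (n : ℕ) :
    (1 - a) / (1 - a * q ^ (2 * n)) *
      (qPochs [-q, a * q / b] q n / qPochs [a, -b] q n) *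
      (qPoch (a * b * q ^ 2) (q ^ 2) n / qPoch (a / b) (q ^ 2) n) * q ^ (-(n : ℤ)) =
      quadValue a b q 0 n := by
  simp [quadValue, qPochs, ellPoch_zero_right, theta_zero_right]

lemma qPhi_eq_sum {a b q : ℂ} (hq : q ≠ 0) (n : ℕ) :
    qPhi [b, b * q, a ^ 2 * q ^ (2 * n), q ^ (-2 * (n : ℤ))] [b ^ 2, a * q, a * q ^ 2]
        (q ^ 2) (q ^ 2) =
      ∑ k ∈ Finset.range (n + 1), qPoch (a ^ 2 * (q ^ 2) ^ n) (q ^ 2) k *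
        qPoch ((q ^ 2) ^ n)⁻¹ (q ^ 2) k / (qPoch (q ^ 2) (q ^ 2) k * qPoch (b ^ 2) (q ^ 2) k) *
        (qPoch b q (2 * k) / qPoch (a * q) q (2 * k)) * (q ^ 2) ^ k := by
  rw [qPhi, zpow_neg_two_mul_natCast, pow_mul q 2 n]
  have h : ∀ k ∉ Finset.range (n + 1), qPoch (a ^ 2 * (q ^ 2) ^ n) (q ^ 2) k *
      qPoch ((q ^ 2) ^ n)⁻¹ (q ^ 2) k / (qPoch (q ^ 2) (q ^ 2) k * qPoch (b ^ 2) (q ^ 2) k) *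
      (qPoch b q (2 * k) / qPoch (a * q) q (2 * k)) * (q ^ 2) ^ k = 0 := fun k hk => by
    rw [← ellPoch_zero_right ((q ^ 2) ^ n)⁻¹, ellPoch_inv_pow_eq_zero (pow_ne_zero 2 hq)
      (by rw [Finset.mem_range] at hk; omega)]
    simp
  have h' : ∑' k, _ = _ := tsum_eq_sum h
  rw [← h']
  congr 1
  ext k
  rw [← qPoch_sq_mul b, ← qPoch_sq_mul (a * q), show a * q * q = a * q ^ 2 by ring]
  simp only [qPochs, List.map_cons, List.map_nil, List.prod_cons, List.prod_nil, mul_one]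
  ring

/-- The elliptic denominators, in terms of `quadDenom`. -/
lemma quadDenom_ne_zero {a b q p : ℂ} (ha : a ≠ 0) (hq : q ≠ 0) (hp0 : p ≠ 0)
    (hp : ‖p‖ < 1) {n : ℕ} (h1 : theta (a * b) (p ^ 2) ≠ 0)
    (h2 : ellPochs [q ^ 2, a * q ^ 2, a * q, a * p * q ^ 2, a * q / p, b ^ 2,
      b * q ^ (2 - 2 * (n : ℤ)) / a, a * b * q ^ (2 * n + 2)] (q ^ 2) (p ^ 2) n ≠ 0)
    (h3 : theta (a * q ^ (2 * n)) p ≠ 0) (h4 : ellPochs [a, -b] q p n ≠ 0)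
    (h5 : ellPoch (a / b) (q ^ 2) (p ^ 2) n ≠ 0) : quadDenom a b q p n ≠ 0 := by
  rw [mul_zpow_two_sub_div ha hq, show a * b * q ^ (2 * n + 2) = a * b * (q ^ 2) ^ (n + 1) by ring]
    at h2
  simp only [ellPochs, List.map_cons, List.map_nil, List.prod_cons, List.prod_nil, mul_one,
    mul_ne_zero_iff] at h2 h4
  obtain ⟨e1, e2, e3, e4, e5, e6, e7, e8⟩ := h2
  rw [ellPoch_div_sq (mul_ne_zero ha hq) (pow_ne_zero 2 hq) hp0 hp] at e5
  rw [show a * q ^ 2 = a * q * q by ring] at e2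
  rw [show a * p * q ^ 2 = a * q * q * p by ring] at e4
  have e9 : ellPoch (a * q) q p (2 * n) ≠ 0 := by
    rw [← ellPoch_sq_mul, ← ellPoch_mul_base (a * q) hp0 hp, ← ellPoch_mul_base (a * q * q) hp0 hp]
    exact mul_ne_zero (mul_ne_zero e3 (right_ne_zero_of_mul e5)) (mul_ne_zero e2 e4)
  simp only [quadDenom, mul_ne_zero_iff]
  tauto

/-- The quadratic sum and its closed form are continuous at `p = 0`, so the limit of the elliptic
summation is the sum of the limits. -/
lemma quadSum_limit {a b q : ℂ} (ha : a ≠ 0) (hb : b ≠ 0) (hq : q ≠ 0) {n : ℕ}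
    (hD : quadDenom a b q 0 n ≠ 0) :
    Tendsto (fun p => ∑ k ∈ Finset.range (n + 1), quadTerm a b q p n k) (𝓝[≠] 0)
      (𝓝 (∑ k ∈ Finset.range (n + 1), quadTerm a b q 0 n k)) ∧
    Tendsto (fun p => quadValue a b q p n) (𝓝[≠] 0) (𝓝 (quadValue a b q 0 n)) ∧
    ∑ k ∈ Finset.range (n + 1), quadTerm a b q 0 n k = quadValue a b q 0 n := by
  have h0 : ‖(id 0 : ℂ)‖ < 1 := by simp
  have t1 : ContinuousAt (fun p => ∑ k ∈ Finset.range (n + 1), quadTerm a b q p n k) 0 :=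
    tendsto_finsetSum _ fun k hk => continuousAt_quadTerm (f := fun _ => a) (g := id)
      continuousAt_const continuousAt_id ha h0 hb hq hD
      (by have := Finset.mem_range.mp hk; omega)
  have t2 : ContinuousAt (fun p => quadValue a b q p n) 0 :=
    continuousAt_quadValue (f := fun _ => a) (g := id) continuousAt_const continuousAt_id ha h0 hb
      hq hD
  have t3 : ContinuousAt (fun p => quadDenom a b q p n) 0 :=
    continuousAt_quadDenom (f := fun _ => a) (g := id) continuousAt_const continuousAt_id ha h0 hb
      hq
  have t1' := t1.tendsto.mono_left (nhdsWithin_le_nhds (s := {0}ᶜ))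
  have t2' := t2.tendsto.mono_left (nhdsWithin_le_nhds (s := {0}ᶜ))
  have t3' := t3.tendsto.mono_left (nhdsWithin_le_nhds (s := {0}ᶜ))
  refine ⟨t1', t2', tendsto_nhds_unique_of_eventuallyEq t1' t2' ?_⟩
  filter_upwards [eventually_punctured_norm_lt_one, t3'.eventually_ne hD] with p hp hDp
  exact sum_quadTerm ha hb hq hp.1 hp.2 hDp

end Elliptic

theorem mainTheorem1 (n : ℕ) (a b q : ℂ) (ha : a ≠ 0) (hb : b ≠ 0) (hq : q ≠ 0) :
    -- the elliptic summation
    (∀ p : ℂ, 0 < ‖p‖ → ‖p‖ < 1 →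
      -- no denominator on the left vanishes
      Elliptic.theta (a * b) (p ^ 2) ≠ 0 →
      Elliptic.ellPochs [q ^ 2, a * q ^ 2, a * q, a * p * q ^ 2, a * q / p, b ^ 2,
        b * q ^ (2 - 2 * (n : ℤ)) / a, a * b * q ^ (2 * n + 2)] (q ^ 2) (p ^ 2) n ≠ 0 →
      -- no denominator on the right vanishes
      Elliptic.theta (a * q ^ (2 * n)) p ≠ 0 →
      Elliptic.ellPochs [a, -b] q p n ≠ 0 →
      Elliptic.ellPoch (a / b) (q ^ 2) (p ^ 2) n ≠ 0 →
      (∀ k : ℕ, n < k →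
        Elliptic.ellVTerm (a * b) [b, b * q, b / p, b * q * p, a * q ^ 2 / b,
          a ^ 2 * q ^ (2 * n), q ^ (-2 * (n : ℤ))] (q ^ 2) (p ^ 2) k = 0) ∧
      Elliptic.ellV (a * b) [b, b * q, b / p, b * q * p, a * q ^ 2 / b,
          a ^ 2 * q ^ (2 * n), q ^ (-2 * (n : ℤ))] (q ^ 2) (p ^ 2) =
        Elliptic.theta a p / Elliptic.theta (a * q ^ (2 * n)) p *
          (Elliptic.ellPochs [-q, a * q / b] q p n / Elliptic.ellPochs [a, -b] q p n) *
          (Elliptic.ellPoch (a * b * q ^ 2) (q ^ 2) (p ^ 2) n /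
            Elliptic.ellPoch (a / b) (q ^ 2) (p ^ 2) n) * q ^ (-(n : ℤ))) ∧
    -- its limit as `p → 0`
    (1 - a * b ≠ 0 →
      Elliptic.qPochs [q ^ 2, a * q ^ 2, a * q, b ^ 2,
        b * q ^ (2 - 2 * (n : ℤ)) / a, a * b * q ^ (2 * n + 2)] (q ^ 2) n ≠ 0 →
      1 - a * q ^ (2 * n) ≠ 0 →
      Elliptic.qPochs [a, -b] q n ≠ 0 →
      Elliptic.qPoch (a / b) (q ^ 2) n ≠ 0 →
      Tendsto (fun p : ℂ => Elliptic.ellV (a * b) [b, b * q, b / p, b * q * p, a * q ^ 2 / b,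
          a ^ 2 * q ^ (2 * n), q ^ (-2 * (n : ℤ))] (q ^ 2) (p ^ 2)) (𝓝[≠] 0)
        (𝓝 (Elliptic.qW (a * b) [b, b * q, a * q ^ 2 / b, a ^ 2 * q ^ (2 * n),
          q ^ (-2 * (n : ℤ))] (q ^ 2) (b * q / a))) ∧
      Tendsto (fun p : ℂ => Elliptic.theta a p / Elliptic.theta (a * q ^ (2 * n)) p *
          (Elliptic.ellPochs [-q, a * q / b] q p n / Elliptic.ellPochs [a, -b] q p n) *
          (Elliptic.ellPoch (a * b * q ^ 2) (q ^ 2) (p ^ 2) n /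
            Elliptic.ellPoch (a / b) (q ^ 2) (p ^ 2) n) * q ^ (-(n : ℤ))) (𝓝[≠] 0)
        (𝓝 ((1 - a) / (1 - a * q ^ (2 * n)) *
          (Elliptic.qPochs [-q, a * q / b] q n / Elliptic.qPochs [a, -b] q n) *
          (Elliptic.qPoch (a * b * q ^ 2) (q ^ 2) n / Elliptic.qPoch (a / b) (q ^ 2) n) *
          q ^ (-(n : ℤ)))) ∧
      Elliptic.qW (a * b) [b, b * q, a * q ^ 2 / b, a ^ 2 * q ^ (2 * n),
          q ^ (-2 * (n : ℤ))] (q ^ 2) (b * q / a) =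
        (1 - a) / (1 - a * q ^ (2 * n)) *
          (Elliptic.qPochs [-q, a * q / b] q n / Elliptic.qPochs [a, -b] q n) *
          (Elliptic.qPoch (a * b * q ^ 2) (q ^ 2) n / Elliptic.qPoch (a / b) (q ^ 2) n) *
          q ^ (-(n : ℤ))) ∧
    -- the balanced `₄φ₃` sum
    (Elliptic.qPochs [q ^ 2, b ^ 2, a * q, a * q ^ 2] (q ^ 2) n ≠ 0 →
      1 - a * q ^ (2 * n) ≠ 0 →
      Elliptic.qPochs [a, -b] q n ≠ 0 →
      Elliptic.qPhi [b, b * q, a ^ 2 * q ^ (2 * n), q ^ (-2 * (n : ℤ))]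
          [b ^ 2, a * q, a * q ^ 2] (q ^ 2) (q ^ 2) =
        (1 - a) / (1 - a * q ^ (2 * n)) *
          (Elliptic.qPochs [-q, a * q / b] q n / Elliptic.qPochs [a, -b] q n) * b ^ n) := by
  refine ⟨fun p hp0' hp h1 h2 h3 h4 h5 => ?_, fun h1 h2 h3 h4 h5 => ?_, fun h1 h2 h3 => ?_⟩
  · have hp0 : p ≠ 0 := norm_pos_iff.mp hp0'
    refine ⟨fun k hk => ?_, ?_⟩
    · rw [Elliptic.ellVTerm_eq_quadTerm ha hb hq hp0 hp, Elliptic.quadTerm_eq_zero hq hk]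
    · rw [Elliptic.ellV_eq_sum_quadTerm ha hb hq hp0 hp, Elliptic.closedForm_eq_quadValue]
      exact Elliptic.sum_quadTerm ha hb hq hp0 hp
        (Elliptic.quadDenom_ne_zero ha hq hp0 hp h1 h2 h3 h4 h5)
  · obtain ⟨t1, t2, h⟩ := Elliptic.quadSum_limit ha hb hq
      (Elliptic.quadDenom_zero_ne_zero ha h1 h2 hq h3 h4 h5)
    rw [← Elliptic.qW_eq_sum_quadTerm ha hb hq] at t1 h
    rw [← Elliptic.qClosedForm_eq_quadValue] at t2 h
    refine ⟨t1.congr' ?_, t2.congr fun p => (Elliptic.closedForm_eq_quadValue a b q p n).symm, h⟩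
    filter_upwards [Elliptic.eventually_punctured_norm_lt_one] with p hp
    exact (Elliptic.ellV_eq_sum_quadTerm ha hb hq hp.1 hp.2 n).symm
  · simp only [Elliptic.qPochs, List.map_cons, List.map_nil, List.prod_cons, List.prod_nil,
      mul_one, mul_ne_zero_iff] at h1 h3
    obtain ⟨e1, e2, e3, e4⟩ := h1
    have e5 : Elliptic.qPoch (a * q) q (2 * n) ≠ 0 := by
      rw [← Elliptic.qPoch_sq_mul, show a * q * q = a * q ^ 2 by ring]
      exact mul_ne_zero e3 e4
    rw [Elliptic.qPhi_eq_sum hq, Elliptic.sum_balanced ha hb hq e1 e2 e5 h2 h3.1 h3.2]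
    simp [Elliptic.qPochs]
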